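/- Let $\mathcal S$ be a complete separable metric space with a non-atomic, $\sigma$-finite Borel measure $|\cdot|$ (write $\mathrm du$ for it) that is finite on bounded sets. Let $\mathbf N$ be the set of locally finite subsets of $\mathcal S$ (those with finitely many points in every bounded set), with the $\sigma$-algebra generated by the counts $\mathbf x\mapsto\#(\mathbf x\cap A)$, $A$ bounded Borel. Let $X$ be a (simple) point process in $\mathcal S$, i.e. a random element of $\mathbf N$, with $\#X<\infty$ almost surely. Let $\lambda_\theta:\mathcal S\times\mathbf N\to[0,\infty)$, $\theta\in\Theta$, be measurable functions such that, for some $\theta_0\in\Theta$, $\lambda_{\theta_0}$ is a Papangelou conditional intensity of $X$, i.e. $\mathbb E\sum_{u\in X}g(u,X\setminus\{u\})=\int_{\mathcal S}\mathbb E[g(u,X)\lambda_{\theta_0}(u|X)]\,\mathrm du$ for all measurable $g\ge0$. Let $h_\theta$, $\theta\in\Theta$, be measurable (test) functions on $\mathcal S\times\mathbf N$ with values in $\mathbb R$ or, more generally, in a finite-dimensional real normed space. For bounded Borel $A$, $\mathbf z,\mathbf y\in\mathbf N$ and a function $\xi$ on $\mathcal S\times\mathbf N$, the prediction error is $$\mathcal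 I^{h_\theta}_{\xi}(A;\mathbf z,\mathbf y)=\sum_{x\in\mathbf z\cap A}h_\theta(x;\mathbf y\setminus\{x\})-\int_A h_\theta(u;\mathbf y)\,\xi(u;\mathbf y)\,\mathrm du .$$ For each $k\ge2$ let $\{(X_i^T(p_k),X_i^V(p_k))\}_{i=1}^k$ be a Monte-Carlo cross-validation of $X$ with retention probability $p_k=1/\sqrt k$: conditionally on $X$, each point of $X$ is put into $X_i^V(p_k)$ with probability $p_k$, independently over all points and all $i=1,\ldots,k$, and $X_i^T(p_k)=X\setminus X_i^V(p_k)$. Let $$\xi_\theta(u;X_i^T(p_k))=V_\theta(u)\,\lambda_\theta(u|X_i^T(p_k)),\qquad V_\theta(u)=p_k\,\mathbb E\!\left[\frac{\lambda_\theta(u|X)}{\lambda_\theta(u|X_i^T(p_k))}\,\middle|\,X_i^T(p_k)\right],$$ where $V_\theta$ is a version that is jointly measurable in $u$ and $X_i^T(p_k)$, with $0/0=0$, $a/0=\infty$ for $a>0$, and $\infty\cdot0=0$. Assume that, for every $\theta\in\Theta$, $\lambda_\theta$ and $h_\theta$ are bounded on $\mathcal S\times\mathbf N$. Then, for every $\theta\in\Theta$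 and every bounded Borel set $A\subseteq\mathcal S$, $$p_k\sum_{i=1}^k\mathcal I^{h_\theta}_{\xi_\theta}(A;X_i^V(p_k),X_i^T(p_k))-\mathcal I^{h_\theta}_{\lambda_\theta}(A;X,X)\to0\quad\text{in probability as }k\to\infty .$$ Consequently, the loss $\mathcal L_3(\theta)=\bigl\|\frac1k\sum_{i=1}^k\mathcal I^{h_\theta}_{\xi_\theta}(A;X_i^V(p_k),X_i^T(p_k))\bigr\|^2$ satisfies $k\,\mathcal L_3(\theta)-\|\mathcal I^{h_\theta}_{\lambda_\theta}(A;X,X)\|^2\to0$ in probability, so that Takacs-Fiksel estimation is a limiting case of point process learning with the $\mathcal L_3$ loss. -/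

import Mathlib

open MeasureTheory ProbabilityTheory Filter Topology
open scoped ENNReal NNReal

/-- A locally finite point configuration of `S`: a set of points (hence without multiplicities)
having finitely many points in every bounded set. -/
@[ext]
structure PointConfig (S : Type*) [MetricSpace S] where
  carrier : Set S
  finite_inter : ∀ A : Set S, Bornology.IsBounded A → (carrier ∩ A).Finite

namespace PointConfig

/-- The `σ`-algebra on configurations generated by the counts `x ↦ #(x ∩ A)`, `A` bounded Borel. -/
noncomputable instance {S : Type*} [MetricSpace S] [MeasurableSpace S] : MeasurableSpace (PointConfig S) :=
  ⨆ (A : Set S) (_ : MeasurableSet A) (_ : Bornology.IsBounded A),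
    MeasurableSpace.comap (fun x : PointConfig S => (x.carrier ∩ A).ncard) ⊤

/-- The set difference `x \ y`. -/
def diff {S : Type*} [MetricSpace S] (x y : PointConfig S) : PointConfig S where
  carrier := x.carrier \ y.carrier
  finite_inter A hA :=
    (x.finite_inter A hA).subset (Set.inter_subset_inter_left A Set.sdiff_subset)

/-- The configuration `x \ {u}`. -/
def erase {S : Type*} [MetricSpace S] (x : PointConfig S) (u : S) : PointConfig S where
  carrier := x.carrier \ {u}
  finite_inter A hA :=
    (x.finite_inter A hA).subset (Set.inter_subset_inter_left A Set.sdiff_subset)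

/-- The thinning of `x` by the binary marking `m`: the points of `x` that carry the mark `true`. -/
def retain {S : Type*} [MetricSpace S] (x : PointConfig S) (m : x.carrier → Bool) :
    PointConfig S where
  carrier := {u | ∃ hu : u ∈ x.carrier, m ⟨u, hu⟩ = true}
  finite_inter A hA :=
    (x.finite_inter A hA).subset (Set.inter_subset_inter_left A fun _ hu => hu.1)

end PointConfig

/-- The point process `X` has (Papangelou) conditional intensity `lam` with respect to the
reference measure `vol`: the Georgii-Nguyen-Zessin formula holds for all nonnegative measurable
functions. -/
def HasConditionalIntensity {S Ω : Type*} [MetricSpace S] [MeasurableSpace S] [MeasurableSpace Ω]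
    (vol : Measure S) (P : Measure Ω) (X : Ω → PointConfig S) (lam : S → PointConfig S → ℝ≥0) :
    Prop :=
  ∀ g : S → PointConfig S → ℝ≥0∞, Measurable (Function.uncurry g) →
    ∫⁻ ω, ∑' u : (X ω).carrier, g u ((X ω).erase u) ∂P =
      ∫⁻ u, ∫⁻ ω, g u (X ω) * lam u (X ω) ∂P ∂vol

/-- `XV 0, …, XV (k - 1)` are the validation sets of a Monte-Carlo cross-validation of `X` with `k`
folds and retention probability `p`: conditionally on `X` they arise from marks `m (i, x)`,
`i < k`, `x ∈ X`, that are independent and Bernoulli with parameter `p`, the point `x` being put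
into `XV i` if and only if `m (i, x)` is `true`. -/
structure IsMonteCarloCV {S Ω : Type*} [MetricSpace S] [MeasurableSpace S] [MeasurableSpace Ω]
    (P : Measure Ω) (X : Ω → PointConfig S) (k : ℕ) (p : unitInterval)
    (XV : Fin k → Ω → PointConfig S) : Prop where
  measurable : ∀ i, Measurable (XV i)
  subset : ∀ i ω, (XV i ω).carrier ⊆ (X ω).carrier
  lintegral_eq : ∀ g : PointConfig S → (Fin k → PointConfig S) → ℝ≥0∞,
    Measurable (Function.uncurry g) →
      ∫⁻ ω, g (X ω) (fun i => XV i ω) ∂P =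
        ∫⁻ ω, ∫⁻ m : Fin k × (X ω).carrier → Bool,
            g (X ω) (fun i => (X ω).retain fun u => m (i, u))
          ∂(Measure.infinitePi fun _ : Fin k × (X ω).carrier => bernoulliMeasure true false p) ∂P

/-- `V` is a (jointly measurable version of the) PPL-weight
`V(u) = p * E[lam(u | X) / lam(u | XT) | XT]` of an independent thinning with constant retention
probability `p`, where `XT` is the training set. The quotient is taken in `[0, ∞]`, so that
`0 / 0 = 0`. -/
structure IsPPLWeight {S Ω : Type*} [MetricSpace S] [MeasurableSpace S] [MeasurableSpace Ω]
    (vol : Measure S) (P : Measure Ω) (X XT : Ω → PointConfig S) (p : unitInterval)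
    (lam : S → PointConfig S → ℝ≥0) (V : S → PointConfig S → ℝ≥0∞) : Prop where
  measurable : Measurable (Function.uncurry V)
  ae_eq : ∀ᵐ u ∂vol, (fun ω => V u (XT ω)) =ᵐ[P] fun ω =>
    ENNReal.ofReal p *
      condLExp (MeasurableSpace.comap XT inferInstance) P
        (fun ω' => (lam u (X ω') : ℝ≥0∞) / (lam u (XT ω') : ℝ≥0∞)) ω

/-- The estimator `ξ(u; y) = V(u; y) * lam(u | y)` used in point process learning. -/
noncomputable def pplEstimator {S : Type*} [MetricSpace S]
    (V : S → PointConfig S → ℝ≥0∞) (lam : S → PointConfig S → ℝ≥0)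
    (u : S) (y : PointConfig S) : ℝ :=
  (V u y * lam u y).toReal

/-- The `h`-weighted prediction error
`∑_{x ∈ z ∩ A} h(x; y \ {x}) - ∫_A h(u; y) ξ(u; y) du`
for predicting `z` from `y`, with a (possibly vector-valued) test function `h`. -/
noncomputable def predictionError {S E : Type*} [MetricSpace S] [MeasurableSpace S]
    [NormedAddCommGroup E] [NormedSpace ℝ E] (vol : Measure S)
    (xi : S → PointConfig S → ℝ) (h : S → PointConfig S → E) (A : Set S)
    (z y : PointConfig S) : E :=
  (∑ᶠ x ∈ z.carrier ∩ A, h x (y.erase x)) - ∫ u in A, xi u y • h u y ∂vol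

/-- The innovation `I(A; x, x)` of Takacs-Fiksel estimation: the prediction error with `ξ = lam`
for predicting `x` from `x` itself. -/
noncomputable def innovation {S E : Type*} [MetricSpace S] [MeasurableSpace S]
    [NormedAddCommGroup E] [NormedSpace ℝ E] (vol : Measure S)
    (lam : S → PointConfig S → ℝ≥0) (h : S → PointConfig S → E) (A : Set S)
    (x : PointConfig S) : E :=
  predictionError vol (fun u y => (lam u y : ℝ)) h A x x

/-- The loss function `L₃`: the squared norm of the average of `k` prediction errors. -/
noncomputable def lossL3 {E : Type*} [NormedAddCommGroup E] [NormedSpace ℝ E]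
    {k : ℕ} (e : Fin k → E) : ℝ :=
  ‖(1 / (k : ℝ)) • ∑ i, e i‖ ^ 2

/-- The retention probability `1 / √k`. -/
noncomputable def invSqrtProb (k : ℕ) : unitInterval :=
  ⟨1 / √(k : ℝ), by positivity, by
    rcases Nat.eq_zero_or_pos k with rfl | hk
    · simp
    · exact div_le_one_of_le₀ (Real.one_le_sqrt.2 (by exact_mod_cast hk)) (Real.sqrt_nonneg _)⟩

/-! Everything rests on `k * p ^ 2 = 1` with `p → 0`. Fix a configuration of `n` points. A given
point is validated `k * p = 1 / p` times on average, and `p` times that number has variance `p - p ^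
2`, so it tends to 1. Two given points share a fold only `k * p ^ 2 = 1` times on average, which the
factor `p` makes negligible. Hence `p` times the sum over all validated points is close to the sum
over `X`, and in nearly every term the training set can be replaced by `X` without the point
(`norm_smul_sum_validation_sub_le`).

For the integrals, the pull-out property turns the estimator into `p` times the conditional
expectation of `lam u X` restricted to `lam u XT ≠ 0`. As `XT = X` off the event that the fold is
non-empty, its `L¹` distance from `p * lam u X` is at most a constant times `p * P(fold non-empty)`
(`lintegral_enorm_pplEstimator_smul_sub_le`). Summing over `k` folds and multiplying by `p` leaves
the expected fraction of non-empty folds, which vanishes; the main terms add up to `k * p ^ 2 = 1`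
copies of the integral in the innovation.

The deviations are collected in one functional, `foldError`, whose conditional mean given `X` tends
to 0 for each finite `n` (`lintegral_foldError_retain_le`). Since the number of points need not have
moments, it is truncated at 1 before averaging over `X`. The claim on the loss follows because `k /
k ^ 2 = p ^ 2` and the innovation is tight. -/

/-! ### Conditional expectations of quotients -/

/-- Pull-out property of the conditional Lebesgue expectation. -/
theorem mul_condLExp_ae_eq {Ω : Type*} {m m₀ : MeasurableSpace Ω} (hm : m ≤ m₀)
    (P : Measure[m₀] Ω) [SigmaFinite (P.trim hm)] {f Z : Ω → ℝ≥0∞}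
    (hf : Measurable[m₀] f) (hZ : Measurable[m] Z) :
    (fun ω => Z ω * condLExp m P f ω) =ᵐ[P] condLExp m P (fun ω => Z ω * f ω) := by
  refine ae_eq_condLExp hm P _ (hZ.mul (measurable_condLExp m P f)) fun s hs => ?_
  -- No approximation of `Z` by simple functions is needed: `f` and its conditional expectation are
  -- densities of the same measure on `m`, and `Z` is integrated against that measure.
  have key : (P.withDensity (condLExp m P f)).trim hm = (P.withDensity f).trim hm := by
    refine @Measure.ext _ m _ _ fun t ht => ?_
    rw [trim_measurableSet_eq hm ht, trim_measurableSet_eq hm ht,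
      withDensity_apply _ (hm t ht), withDensity_apply _ (hm t ht),
      setLIntegral_condLExp hm P f ht]
  have hZ' : Measurable[m] (s.indicator Z) := hZ.indicator hs
  have aux : ∀ g : Ω → ℝ≥0∞, Measurable[m₀] g →
      ∫⁻ ω in s, Z ω * g ω ∂P = ∫⁻ ω, s.indicator Z ω ∂((P.withDensity g).trim hm) := by
    intro g hg
    rw [lintegral_trim hm hZ',
      lintegral_withDensity_eq_lintegral_mul P hg (hZ'.mono hm le_rfl),
      ← lintegral_indicator (hm s hs)]
    refine lintegral_congr fun ω => ?_
    by_cases hω : ω ∈ s <;> simp [hω, mul_comm]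
  rw [aux f hf, aux _ (measurable_condLExp' m P f), key]

/-- If `Z` is `m`-measurable and `Y = Z` off the event `B`, then `Z * E[Y / Z | m]` is close to `Z`
in `L¹`. -/
theorem lintegral_enorm_mul_condLExp_div_sub_le {Ω : Type*} {m m₀ : MeasurableSpace Ω}
    (hm : m ≤ m₀) (P : Measure[m₀] Ω) [IsFiniteMeasure P] {Y Z : Ω → ℝ≥0}
    (hY : Measurable[m₀] Y) (hZ : Measurable[m] Z) {C : ℝ≥0} (hYC : ∀ ω, Y ω ≤ C)
    (hZC : ∀ ω, Z ω ≤ C) {B : Set Ω} (hB : MeasurableSet[m₀] B) (hYZ : ∀ ω, ω ∉ B → Y ω = Z ω) :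
    ∫⁻ ω, ‖((condLExp m P (fun ω => (Y ω : ℝ≥0∞) / (Z ω : ℝ≥0∞)) ω) * (Z ω : ℝ≥0∞)).toReal
        - (Z ω : ℝ)‖ₑ ∂P ≤ C * P B := by
  have hZ₀ : Measurable[m₀] Z := hZ.mono hm le_rfl
  -- The quotient may be infinite, but `f` equals `Y` where `Z ≠ 0` and 0 elsewhere, hence is
  -- bounded by `C`. This allows the passage to real conditional expectations.
  set f : Ω → ℝ≥0∞ := fun ω => (Z ω : ℝ≥0∞) * ((Y ω : ℝ≥0∞) / (Z ω : ℝ≥0∞)) with hf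
  have hfm : Measurable[m₀] f := by fun_prop
  have hfY : ∀ ω, f ω ≤ Y ω := fun ω => ENNReal.mul_div_le
  have hfC : ∀ ω, f ω ≤ C := fun ω => (hfY ω).trans (by exact_mod_cast hYC ω)
  have hfB : ∀ ω, ω ∉ B → f ω = Z ω := by
    intro ω hω
    simp only [hf, hYZ ω hω]
    by_cases h0 : Z ω = 0
    · simp [h0]
    · exact ENNReal.mul_div_cancel (by simpa using h0) (by simp)
  have hfint : ∫⁻ ω, f ω ∂P ≠ ∞ := by
    refine ((lintegral_mono hfC).trans_lt ?_).ne
    simp [ENNReal.mul_lt_top]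
  have h1 : (fun ω => ((condLExp m P (fun ω => (Y ω : ℝ≥0∞) / (Z ω : ℝ≥0∞)) ω) *
      (Z ω : ℝ≥0∞)).toReal) =ᵐ[P] P[fun ω => (f ω).toReal | m] := by
    refine EventuallyEq.trans ?_ (toReal_condLExp m hfm.aemeasurable hfint)
    filter_upwards [mul_condLExp_ae_eq hm P (f := fun ω => (Y ω : ℝ≥0∞) / (Z ω : ℝ≥0∞))
      (Z := fun ω => (Z ω : ℝ≥0∞)) (by fun_prop) hZ.coe_nnreal_ennreal] with ω hω
    rw [← hω, mul_comm]
  have hZint : Integrable (fun ω => (Z ω : ℝ)) P := by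
    refine Integrable.of_bound (by fun_prop) C (ae_of_all _ fun ω => ?_)
    simpa using hZC ω
  have hfr : Integrable (fun ω => (f ω).toReal) P :=
    integrable_toReal_of_lintegral_ne_top hfm.aemeasurable hfint
  have h2 : P[fun ω => (Z ω : ℝ) | m] = fun ω => (Z ω : ℝ) :=
    condExp_of_stronglyMeasurable hm (hZ.coe_nnreal_real.stronglyMeasurable) hZint
  -- As `Z` is its own conditional expectation, the error is the conditional expectation of `f - Z`,
  -- and conditioning contracts `L¹`.
  have h3 : P[(fun ω => (f ω).toReal) - (fun ω => (Z ω : ℝ)) | m] =ᵐ[P]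
      fun ω => P[fun ω => (f ω).toReal | m] ω - (Z ω : ℝ) := by
    filter_upwards [condExp_sub hfr hZint m] with ω hω
    rw [hω, Pi.sub_apply, h2]
  calc _ = ∫⁻ ω, ‖P[(fun ω => (f ω).toReal) - (fun ω => (Z ω : ℝ)) | m] ω‖ₑ ∂P := by
        refine lintegral_congr_ae ?_
        filter_upwards [h1, h3] with ω e1 e3
        rw [e3, e1]
    _ ≤ ∫⁻ ω, ‖((fun ω => (f ω).toReal) - (fun ω => (Z ω : ℝ))) ω‖ₑ ∂P := by
        simpa [eLpNorm_one_eq_lintegral_enorm] using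
          eLpNorm_condExp_le_eLpNorm (μ := P) (m := m)
            ((fun ω => (f ω).toReal) - (fun ω => (Z ω : ℝ))) le_rfl
    _ ≤ ∫⁻ ω, B.indicator (fun _ => (C : ℝ≥0∞)) ω ∂P := by
        refine lintegral_mono fun ω => ?_
        by_cases hω : ω ∈ B
        · have e1 : (f ω).toReal ≤ C := ENNReal.toReal_le_coe_of_le_coe (hfC ω)
          have e2 : (Z ω : ℝ) ≤ C := by exact_mod_cast hZC ω
          have e3 : (0 : ℝ) ≤ (f ω).toReal := ENNReal.toReal_nonneg
          have e4 : (0 : ℝ) ≤ Z ω := (Z ω).2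
          simp only [hω, Set.indicator_of_mem, Pi.sub_apply]
          rw [← ofReal_norm, ← ENNReal.ofReal_coe_nnreal]
          exact ENNReal.ofReal_le_ofReal (abs_sub_le_iff.2 ⟨by linarith, by linarith⟩)
        · simp [hω, hfB ω hω]
    _ = C * P B := by rw [lintegral_indicator hB, setLIntegral_const]

/-! ### Moments of Bernoulli marks -/

section BernoulliMoments

variable {ι τ : Type*}

theorem integral_bernoulli_mark (p : unitInterval) (a : ι) :
    ∫ m : ι → Bool, (if m a then (1 : ℝ) else 0)
      ∂(Measure.infinitePi fun _ : ι => bernoulliMeasure true false p) = p := by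
  have h := integral_map (μ := Measure.infinitePi fun _ : ι => bernoulliMeasure true false p)
    (φ := Function.eval a) (measurable_pi_apply a).aemeasurable (f := fun b : Bool => if b then (1 : ℝ) else 0)
    (measurable_of_finite _).aestronglyMeasurable
  rw [(measurePreserving_eval_infinitePi _ a).map_eq, integral_bernoulliMeasure] at h
  simpa using h.symm

theorem integral_bernoulli_mark_mul [DecidableEq ι] (p : unitInterval) (a b : ι) :
    ∫ m : ι → Bool, (if m a then (1 : ℝ) else 0) * (if m b then (1 : ℝ) else 0)
      ∂(Measure.infinitePi fun _ : ι => bernoulliMeasure true false p) =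
      if a = b then (p : ℝ) else (p : ℝ) ^ 2 := by
  split_ifs with hab
  · subst hab
    rw [← integral_bernoulli_mark p a]
    refine integral_congr_ae (ae_of_all _ fun m => ?_)
    by_cases h : m a <;> simp [h]
  · have hind := (iIndepFun_infinitePi (P := fun _ : ι => bernoulliMeasure true false p)
      (X := fun _ b => if b then (1 : ℝ) else 0)
      (fun _ => measurable_of_finite _)).indepFun hab
    have hm : ∀ c : ι, AEStronglyMeasurable (fun m : ι → Bool => if m c then (1 : ℝ) else 0)
        (Measure.infinitePi fun _ : ι => bernoulliMeasure true false p) := fun c =>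
      ((measurable_of_finite (fun b : Bool => if b then (1 : ℝ) else 0)).comp
        (measurable_pi_apply c)).aestronglyMeasurable
    have := hind.integral_mul_eq_mul_integral (hm a) (hm b)
    simp only [integral_bernoulli_mark] at this
    rw [sq, ← this]
    rfl

/-- Diagonal pairs contribute `p`; by injectivity of `c` all other pairs involve distinct,
independent marks and contribute `p ^ 2`. Finiteness of `ι` makes the mark space finite, so
integrability is automatic. -/
theorem integral_sq_sum_bernoulli_mark [Finite ι] [Fintype τ] (p : unitInterval) {c : τ → ι}
    (hc : Function.Injective c) :
    ∫ m : ι → Bool, (∑ t, if m (c t) then (1 : ℝ) else 0) ^ 2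
      ∂(Measure.infinitePi fun _ : ι => bernoulliMeasure true false p) =
      Fintype.card τ * (p : ℝ) + ((Fintype.card τ : ℝ) ^ 2 - Fintype.card τ) * (p : ℝ) ^ 2 := by
  classical
  simp only [sq (∑ t : τ, _), Finset.sum_mul_sum]
  rw [integral_finsetSum _ fun _ _ => .of_finite]
  simp_rw [integral_finsetSum Finset.univ fun _ _ => Integrable.of_finite,
    integral_bernoulli_mark_mul, hc.eq_iff]
  have : ∀ s t : τ, (if s = t then (p : ℝ) else (p : ℝ) ^ 2) =
      (p : ℝ) ^ 2 + if s = t then (p : ℝ) - (p : ℝ) ^ 2 else 0 := by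
    intro s t; split_ifs <;> ring
  simp only [this, Finset.sum_add_distrib, Finset.sum_ite_eq, Finset.mem_univ, if_true,
    Finset.sum_const, Finset.card_univ, nsmul_eq_mul]
  ring

theorem integral_sum_bernoulli_mark [Finite ι] [Fintype τ] (p : unitInterval) (c : τ → ι) :
    ∫ m : ι → Bool, (∑ t, if m (c t) then (1 : ℝ) else 0)
      ∂(Measure.infinitePi fun _ : ι => bernoulliMeasure true false p) =
      Fintype.card τ * (p : ℝ) := by
  rw [integral_finsetSum _ fun _ _ => .of_finite]
  simp [integral_bernoulli_mark]

end BernoulliMoments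

/-- The expected deviation from `1` of `p` times the number of marks, when the number `k` of
candidates satisfies `k * p ^ 2 = 1`. -/
theorem integral_abs_mul_sum_bernoulli_mark_sub_one_le {ι τ : Type*} [Finite ι] [Fintype τ]
    (p : unitInterval) (hp : (Fintype.card τ : ℝ) * (p : ℝ) ^ 2 = 1) {c : τ → ι}
    (hc : Function.Injective c) :
    ∫ m : ι → Bool, |(p : ℝ) * (∑ t, if m (c t) then (1 : ℝ) else 0) - 1|
      ∂(Measure.infinitePi fun _ : ι => bernoulliMeasure true false p) ≤ 2 * √(p : ℝ) := by
  set μ := Measure.infinitePi fun _ : ι => bernoulliMeasure true false p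
  have hp0 : (0 : ℝ) < p := by
    rcases p.2.1.lt_or_eq with h | h
    · exact h
    · rw [← h] at hp; norm_num at hp
  set δ := √(p : ℝ) with hδ
  have hδ0 : 0 < δ := Real.sqrt_pos.2 hp0
  have hδp : δ ^ 2 = p := Real.sq_sqrt hp0.le
  -- This is `|t| ≤ δ + δ⁻¹ * t ^ 2` at `t = p * N - 1`, expanded. Since `t ^ 2` has mean `p - p ^ 2
  -- ≤ δ ^ 2`, the choice `δ = √p` balances the two terms.
  have hpt : ∀ m : ι → Bool, |(p : ℝ) * (∑ t, if m (c t) then (1 : ℝ) else 0) - 1| ≤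
      (δ + δ⁻¹) + δ⁻¹ * (p : ℝ) ^ 2 * (∑ t, if m (c t) then (1 : ℝ) else 0) ^ 2
        + (-2 * δ⁻¹ * p) * (∑ t, if m (c t) then (1 : ℝ) else 0) := by
    intro m
    set N := ∑ t, if m (c t) then (1 : ℝ) else 0
    have key : ∀ t : ℝ, |t| ≤ δ + δ⁻¹ * t ^ 2 := by
      intro t
      have : δ * |t| ≤ δ * (δ + δ⁻¹ * t ^ 2) := by
        rw [mul_add, ← mul_assoc, mul_inv_cancel₀ hδ0.ne', one_mul, ← sq_abs t]
        nlinarith [sq_nonneg (δ - |t|), abs_nonneg t, hδ0]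
      exact le_of_mul_le_mul_left this hδ0
    refine (key _).trans (le_of_eq ?_)
    ring
  refine (integral_mono .of_finite .of_finite hpt).trans ?_
  rw [integral_add .of_finite .of_finite, integral_add .of_finite .of_finite, integral_const_mul,
    integral_const_mul, integral_sq_sum_bernoulli_mark p hc, integral_sum_bernoulli_mark]
  simp only [integral_const, probReal_univ, one_smul]
  set K := (Fintype.card τ : ℝ)
  have : δ + δ⁻¹ + δ⁻¹ * (p : ℝ) ^ 2 * (K * p + (K ^ 2 - K) * (p : ℝ) ^ 2)
      + -2 * δ⁻¹ * p * (K * p) = δ + δ⁻¹ * (p - p ^ 2) := by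
    have e : (p : ℝ) ^ 2 * (K * p + (K ^ 2 - K) * (p : ℝ) ^ 2) = p + 1 - p ^ 2 := by
      linear_combination (p + 1 + K * p ^ 2 - p ^ 2) * hp
    rw [mul_assoc δ⁻¹, e]
    linear_combination (-2 * δ⁻¹) * hp
  rw [this]
  have h2 : δ⁻¹ * (p - (p : ℝ) ^ 2) ≤ δ⁻¹ * (δ * δ) :=
    mul_le_mul_of_nonneg_left (by nlinarith [hδp, sq_nonneg (p : ℝ)]) (by positivity)
  rw [← mul_assoc, inv_mul_cancel₀ hδ0.ne', one_mul] at h2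
  linarith

/-! ### Measurability on the space of configurations -/

namespace PointConfig

variable {S : Type*} [MetricSpace S] [MeasurableSpace S]

theorem measurable_ncard_inter {A : Set S} (hA : MeasurableSet A) (hAb : Bornology.IsBounded A) :
    Measurable fun x : PointConfig S => (x.carrier ∩ A).ncard := by
  have h : MeasurableSpace.comap (fun x : PointConfig S => (x.carrier ∩ A).ncard) ⊤ ≤
      (inferInstance : MeasurableSpace (PointConfig S)) :=
    le_iSup_of_le A (le_iSup_of_le hA (le_iSup_of_le hAb le_rfl))
  exact Measurable.mono (comap_measurable _) h le_rfl

theorem measurable_of_ncard_inter {Ω : Type*} [MeasurableSpace Ω] {X : Ω → PointConfig S}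
    (h : ∀ A : Set S, MeasurableSet A → Bornology.IsBounded A →
      Measurable fun ω => ((X ω).carrier ∩ A).ncard) : Measurable X := by
  rw [measurable_iff_comap_le]
  simp only [instMeasurableSpace, MeasurableSpace.comap_iSup, MeasurableSpace.comap_comp,
    iSup_le_iff]
  exact fun A hA hAb => (h A hA hAb).comap_le

theorem measurable_diff {Ω : Type*} [MeasurableSpace Ω] {X Y : Ω → PointConfig S}
    (hX : Measurable X) (hY : Measurable Y) (hYX : ∀ ω, (Y ω).carrier ⊆ (X ω).carrier) :
    Measurable fun ω => (X ω).diff (Y ω) := by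
  refine measurable_of_ncard_inter fun A hA hAb => ?_
  have : (fun ω => (((X ω).diff (Y ω)).carrier ∩ A).ncard) =
      fun ω => ((X ω).carrier ∩ A).ncard - ((Y ω).carrier ∩ A).ncard := by
    funext ω
    have : ((X ω).diff (Y ω)).carrier ∩ A = ((X ω).carrier ∩ A) \ ((Y ω).carrier ∩ A) := by
      ext u; simp only [diff, Set.mem_inter_iff, Set.mem_sdiff]; tauto
    rw [this, Set.ncard_sdiff (Set.inter_subset_inter_left A (hYX ω)) ((Y ω).finite_inter A hAb)]
  rw [this]
  exact ((measurable_ncard_inter hA hAb).comp hX).sub ((measurable_ncard_inter hA hAb).comp hY)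

/-- The `σ`-algebra sees only counts in bounded sets. A finite configuration eventually lies in a
large ball, so global functionals become limits of bounded ones. -/
theorem exists_bounded_exhaustion (S : Type*) [MetricSpace S] [MeasurableSpace S]
    [OpensMeasurableSpace S] :
    ∃ K : ℕ → Set S, (∀ n, MeasurableSet (K n)) ∧ (∀ n, Bornology.IsBounded (K n)) ∧
      ∀ s : Set S, s.Finite → ∀ᶠ n in atTop, s ⊆ K n := by
  rcases isEmpty_or_nonempty S with h | ⟨⟨o⟩⟩
  · exact ⟨fun _ => ∅, fun _ => .empty, fun _ => Bornology.isBounded_empty,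
      fun s _ => Eventually.of_forall fun _ u => h.elim u⟩
  · refine ⟨fun n => Metric.ball o n, fun n => measurableSet_ball, fun n => Metric.isBounded_ball,
      fun s hs => ?_⟩
    obtain ⟨r, hr⟩ := hs.isBounded.subset_ball o
    obtain ⟨N, hN⟩ := exists_nat_ge r
    filter_upwards [eventually_ge_atTop N] with n hn
    exact hr.trans (Metric.ball_subset_ball (hN.trans (by exact_mod_cast hn)))

/-- The number of points of an almost surely finite point process is a random variable. -/
theorem aemeasurable_ncard [OpensMeasurableSpace S] {Ω : Type*} [MeasurableSpace Ω]
    {P : Measure Ω} {X : Ω → PointConfig S} (hX : Measurable X)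
    (hfin : ∀ᵐ ω ∂P, (X ω).carrier.Finite) : AEMeasurable (fun ω => (X ω).carrier.ncard) P := by
  obtain ⟨K, hK, hKb, hKex⟩ := exists_bounded_exhaustion S
  refine aemeasurable_of_tendsto_metrizable_ae atTop
    (f := fun n ω => ((X ω).carrier ∩ K n).ncard)
    (fun n => ((measurable_ncard_inter (hK n) (hKb n)).comp hX).aemeasurable) ?_
  filter_upwards [hfin] with ω hω
  refine tendsto_const_nhds.congr' ?_
  filter_upwards [hKex _ hω] with n hn
  rw [Set.inter_eq_left.2 hn]

/-! ### The fold error and its conditional mean -/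

/-- A functional of the total deviations of the folds of a cross-validation from their typical
behaviour: each point should be validated about `1 / p` times, no two points should be validated in
the same fold, and most folds should be empty. -/
noncomputable def foldError {k : ℕ} (p : ℝ) (x : PointConfig S) (v : Fin k → PointConfig S) : ℝ :=
  (∑ᶠ u ∈ x.carrier, |p * (∑ i, (v i).carrier.indicator (fun _ => (1 : ℝ)) u) - 1|)
    + p * ∑ i, ((v i).carrier.ncard : ℝ) * ((v i).carrier.ncard - 1)
    + p ^ 2 * ∑ i, min 1 ((v i).carrier.ncard : ℝ)

/-- On finite configurations, `foldError` agrees with a jointly measurable functional. -/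
theorem exists_measurable_eq_foldError [BorelSpace S] [SecondCountableTopology S] (k : ℕ) (p : ℝ) :
    ∃ g : PointConfig S → (Fin k → PointConfig S) → ℝ≥0∞, Measurable (Function.uncurry g) ∧
      ∀ x v, x.carrier.Finite → (∀ i, (v i).carrier ⊆ x.carrier) →
        g x v = ENNReal.ofReal (foldError p x v) := by
  classical
  obtain ⟨K, hK, hKb, hKex⟩ := exists_bounded_exhaustion S
  obtain ⟨φ, hφ, hφinj⟩ := MeasurableSpace.measurable_injection_nat_bool_of_countablySeparated S
  -- The first `n` bits of an injection into Cantor space. They cut `K n` into finitely many cells,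
  -- which for large `n` contain at most one point of a finite configuration each; a sum over points
  -- thus becomes a sum of cell counts.
  let π : (n : ℕ) → S → Fin n → Bool := fun n u j => φ u j
  have hπ : ∀ n, Measurable (π n) := fun n =>
    measurable_pi_lambda _ fun j => (measurable_pi_apply _).comp hφ
  let B : (n : ℕ) → (Fin n → Bool) → Set S := fun n a => (π n) ⁻¹' {a} ∩ K n
  have hB : ∀ n a, MeasurableSet (B n a) := fun n a => (hπ n (measurableSet_singleton a)).inter (hK n)
  have hBb : ∀ n a, Bornology.IsBounded (B n a) := fun n a => (hKb n).subset Set.inter_subset_right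
  -- Subtracting the count of the configuration instead of 1 makes empty cells contribute nothing.
  let F : ℕ → PointConfig S × (Fin k → PointConfig S) → ℝ := fun n y =>
    (∑ a : Fin n → Bool, |p * (∑ i, (((y.2 i).carrier ∩ B n a).ncard : ℝ))
        - ((y.1.carrier ∩ B n a).ncard : ℝ)|)
    + p * ∑ i, (((y.2 i).carrier ∩ K n).ncard : ℝ) * (((y.2 i).carrier ∩ K n).ncard - 1)
    + p ^ 2 * ∑ i, min 1 (((y.2 i).carrier ∩ K n).ncard : ℝ)
  have hFm : ∀ n, Measurable (F n) := by
    intro n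
    have h1 : ∀ (A : Set S), MeasurableSet A → Bornology.IsBounded A → ∀ i : Fin k,
        Measurable fun y : PointConfig S × (Fin k → PointConfig S) =>
          (((y.2 i).carrier ∩ A).ncard : ℝ) := fun A hA hAb i =>
      (measurable_from_nat (f := fun j : ℕ => (j : ℝ))).comp ((measurable_ncard_inter hA hAb).comp
        ((measurable_pi_apply i).comp measurable_snd))
    have h2 : ∀ (A : Set S), MeasurableSet A → Bornology.IsBounded A →
        Measurable fun y : PointConfig S × (Fin k → PointConfig S) =>
          ((y.1.carrier ∩ A).ncard : ℝ) := fun A hA hAb =>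
      (measurable_from_nat (f := fun j : ℕ => (j : ℝ))).comp ((measurable_ncard_inter hA hAb).comp
        measurable_fst)
    refine Measurable.add (Measurable.add ?_ ?_) ?_
    · exact Finset.measurable_fun_sum _ fun a _ => (((Finset.measurable_fun_sum _ fun i _ =>
        h1 _ (hB n a) (hBb n a) i).const_mul p).sub (h2 _ (hB n a) (hBb n a))).abs
    · exact (Finset.measurable_fun_sum _ fun i _ =>
        (h1 _ (hK n) (hKb n) i).mul ((h1 _ (hK n) (hKb n) i).sub_const 1)).const_mul p
    · exact (Finset.measurable_fun_sum _ fun i _ =>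
        measurable_const.min (h1 _ (hK n) (hKb n) i)).const_mul _
  -- The liminf is measurable on all configurations; on finite ones the sequence is eventually
  -- constant.
  refine ⟨fun x v => liminf (fun n => ENNReal.ofReal (F n (x, v))) atTop,
    Measurable.liminf fun n => (hFm n).ennreal_ofReal, fun x v hx hv => ?_⟩
  refine Tendsto.liminf_eq (tendsto_const_nhds.congr' ?_)
  have hsep : ∀ᶠ n in atTop, Set.InjOn (π n) x.carrier := by
    have : ∀ u ∈ x.carrier, ∀ w ∈ x.carrier, ∀ᶠ n in atTop, π n u = π n w → u = w := by
      intro u _ w _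
      by_cases huw : u = w
      · exact Eventually.of_forall fun _ _ => huw
      · obtain ⟨j, hj⟩ := Function.ne_iff.1 (hφinj.ne huw)
        filter_upwards [eventually_gt_atTop j] with n hn h
        exact absurd (congrFun h ⟨j, hn⟩) hj
    have := (eventually_all_finite hx).2 fun u hu => (eventually_all_finite hx).2 (this u hu)
    filter_upwards [this] with n hn u hu w hw h using hn u hu w hw h
  filter_upwards [hsep, hKex _ hx] with n hn hKn
  have hvK : ∀ i, (v i).carrier ∩ K n = (v i).carrier := fun i =>
    Set.inter_eq_left.2 ((hv i).trans hKn)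
  have hone : ∀ y : PointConfig S, y.carrier ⊆ x.carrier → ∀ u ∈ x.carrier,
      ((y.carrier ∩ B n (π n u)).ncard : ℝ) = y.carrier.indicator (fun _ => (1 : ℝ)) u := by
    intro y hy u hu
    by_cases huy : u ∈ y.carrier
    · have : y.carrier ∩ B n (π n u) = {u} := by
        ext w
        constructor
        · rintro ⟨hw, hw', -⟩
          exact hn (hy hw) hu hw'
        · rintro rfl
          exact ⟨huy, rfl, hKn hu⟩
      simp [this, huy]
    · have : y.carrier ∩ B n (π n u) = ∅ := by
        ext w
        simp only [Set.mem_empty_iff_false, iff_false]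
        rintro ⟨hw, hw', -⟩
        exact huy (hn (hy hw) hu hw' ▸ hw)
      simp [this, huy]
  have hzero : ∀ y : PointConfig S, y.carrier ⊆ x.carrier → ∀ a, a ∉ π n '' x.carrier →
      ((y.carrier ∩ B n a).ncard : ℝ) = 0 := by
    intro y hy a ha
    have : y.carrier ∩ B n a = ∅ := by
      ext w
      simp only [Set.mem_empty_iff_false, iff_false]
      rintro ⟨hw, hw', -⟩
      exact ha ⟨w, hy hw, hw'⟩
    simp [this]
  congr 1
  simp only [F, foldError, hvK]
  congr 2
  rw [finsum_mem_eq_finite_toFinset_sum _ hx]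
  symm
  rw [← Finset.sum_subset (Finset.subset_univ (hx.toFinset.image (π n)))]
  · rw [Finset.sum_image (by simpa using hn)]
    refine Finset.sum_congr rfl fun u hu => ?_
    rw [Set.Finite.mem_toFinset] at hu
    rw [hone x subset_rfl u hu]
    simp only [hone _ (hv _) u hu, Set.indicator_of_mem hu]
  · intro a _ ha
    have ha' : a ∉ π n '' x.carrier := by simpa using ha
    simp [hzero _ (hv _) a ha', hzero x subset_rfl a ha']

/-- The conditional expectation of `foldError` given the configuration. -/
theorem lintegral_foldError_retain_le {S : Type*} [MetricSpace S] {k : ℕ} (p : unitInterval)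
    (hp : (k : ℝ) * (p : ℝ) ^ 2 = 1) (x : PointConfig S) (hx : x.carrier.Finite) :
    ∫⁻ m : Fin k × x.carrier → Bool,
        ENNReal.ofReal (foldError p x fun i => x.retain fun u => m (i, u))
      ∂(Measure.infinitePi fun _ : Fin k × x.carrier => bernoulliMeasure true false p) ≤
      ENNReal.ofReal (2 * x.carrier.ncard * √(p : ℝ) + (x.carrier.ncard : ℝ) ^ 2 * p
        + x.carrier.ncard * p) := by
  classical
  have : Fintype x.carrier := hx.fintype
  set μ := Measure.infinitePi fun _ : Fin k × x.carrier => bernoulliMeasure true false p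
  set n : ℝ := (x.carrier.ncard : ℝ) with hn
  have hcard : (Fintype.card x.carrier : ℝ) = n := by
    rw [hn, ← Nat.card_coe_set_eq, Nat.card_eq_fintype_card]
  let b : (Fin k × x.carrier → Bool) → Fin k → x.carrier → ℝ := fun m i u =>
    if m (i, u) then 1 else 0
  have hind : ∀ m i (u : x.carrier), (x.retain fun u => m (i, u)).carrier.indicator
      (fun _ => (1 : ℝ)) u = b m i u := by
    intro m i u
    by_cases h : m (i, u) <;> simp [b, retain, Set.indicator, h]
  have hnc : ∀ m i, ((x.retain fun u => m (i, u)).carrier.ncard : ℝ) = ∑ u, b m i u := by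
    intro m i
    have : (x.retain fun u => m (i, u)).carrier =
        Subtype.val '' (((Finset.univ.filter fun u : x.carrier => m (i, u)) : Finset x.carrier) :
          Set x.carrier) := by
      ext u; simp [retain]
    rw [this, Set.ncard_image_of_injective _ Subtype.val_injective, Set.ncard_coe_finset]
    simp [b]
  have hF : ∀ m, foldError p x (fun i => x.retain fun u => m (i, u)) =
      (∑ u, |(p : ℝ) * (∑ i, b m i u) - 1|)
        + p * ∑ i, (∑ u, b m i u) * ((∑ u, b m i u) - 1)
        + (p : ℝ) ^ 2 * ∑ i, min 1 (∑ u, b m i u) := by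
    intro m
    simp only [foldError, hnc]
    rw [← finsum_set_coe_eq_finsum_mem, finsum_eq_sum_of_fintype]
    simp only [hind]
  have hb0 : ∀ m i u, 0 ≤ b m i u := fun m i u => by simp only [b]; positivity
  -- Once `min 1 N` is replaced by `N`, the last two terms are polynomials in the marks.
  have hle : ∀ m, foldError p x (fun i => x.retain fun u => m (i, u)) ≤
      (∑ u, |(p : ℝ) * (∑ i, b m i u) - 1|)
        + p * ∑ i, ((∑ u, b m i u) ^ 2 - ∑ u, b m i u)
        + (p : ℝ) ^ 2 * ∑ i, ∑ u, b m i u := by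
    intro m
    rw [hF]
    refine add_le_add (le_of_eq ?_) ?_
    · simp only [mul_sub, sq, mul_one]
    · gcongr
      exact min_le_right _ _
  have hnonneg : ∀ m, 0 ≤ (∑ u, |(p : ℝ) * (∑ i, b m i u) - 1|)
        + p * ∑ i, ((∑ u, b m i u) ^ 2 - ∑ u, b m i u)
        + (p : ℝ) ^ 2 * ∑ i, ∑ u, b m i u := by
    intro m
    have hp0 : (0 : ℝ) ≤ p := p.2.1
    have h1 : 0 ≤ ∑ i, ((∑ u, b m i u) ^ 2 - ∑ u, b m i u) := by
      refine Finset.sum_nonneg fun i _ => ?_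
      rw [← hnc]
      have : ((x.retain fun u => m (i, u)).carrier.ncard) ≤
          ((x.retain fun u => m (i, u)).carrier.ncard) ^ 2 := Nat.le_self_pow (by norm_num) _
      have : (((x.retain fun u => m (i, u)).carrier.ncard : ℕ) : ℝ) ≤
          (((x.retain fun u => m (i, u)).carrier.ncard : ℕ) : ℝ) ^ 2 := by exact_mod_cast this
      linarith
    have h2 : 0 ≤ ∑ i, ∑ u, b m i u :=
      Finset.sum_nonneg fun i _ => Finset.sum_nonneg fun u _ => hb0 m i u
    have h3 : 0 ≤ ∑ u, |(p : ℝ) * (∑ i, b m i u) - 1| :=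
      Finset.sum_nonneg fun u _ => abs_nonneg _
    positivity
  refine (lintegral_mono fun m => ENNReal.ofReal_le_ofReal (hle m)).trans ?_
  rw [← ofReal_integral_eq_lintegral_ofReal .of_finite (ae_of_all _ hnonneg)]
  refine ENNReal.ofReal_le_ofReal ?_
  rw [integral_add .of_finite .of_finite, integral_add .of_finite .of_finite, integral_const_mul,
    integral_const_mul]
  refine add_le_add (add_le_add ?_ ?_) ?_
  · rw [integral_finsetSum _ fun _ _ => .of_finite]
    calc _ ≤ ∑ u : x.carrier, 2 * √(p : ℝ) := Finset.sum_le_sum fun u _ =>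
          integral_abs_mul_sum_bernoulli_mark_sub_one_le p (by simpa using hp)
            (c := fun i : Fin k => (i, u)) fun i j h => (Prod.mk.inj h).1
      _ = _ := by simp only [Finset.sum_const, Finset.card_univ, nsmul_eq_mul, hcard]; ring
  · rw [integral_finsetSum _ fun _ _ => .of_finite]
    -- The mean number of ordered pairs of distinct points in one fold.
    have : ∀ i : Fin k, ∫ m, ((∑ u, b m i u) ^ 2 - ∑ u, b m i u) ∂μ = (n ^ 2 - n) * (p : ℝ) ^ 2 := by
      intro i
      rw [integral_sub .of_finite .of_finite,
        integral_sq_sum_bernoulli_mark p (c := fun u : x.carrier => (i, u))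
          fun _ _ h => (Prod.mk.inj h).2,
        integral_sum_bernoulli_mark p (fun u : x.carrier => (i, u)), hcard]
      ring
    simp only [this, Finset.sum_const, Finset.card_univ, nsmul_eq_mul, Fintype.card_fin]
    have hn0 : 0 ≤ n * p := mul_nonneg (Nat.cast_nonneg _) p.2.1
    have : (p : ℝ) * (k * ((n ^ 2 - n) * (p : ℝ) ^ 2)) = n ^ 2 * p - n * p := by
      linear_combination (p * (n ^ 2 - n)) * hp
    linarith
  · rw [integral_finsetSum _ fun _ _ => .of_finite]
    have : ∀ i : Fin k, ∫ m, (∑ u, b m i u) ∂μ = n * p := by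
      intro i
      rw [integral_sum_bernoulli_mark p (fun u : x.carrier => (i, u)), hcard]
    simp only [this, Finset.sum_const, Finset.card_univ, nsmul_eq_mul, Fintype.card_fin]
    refine le_of_eq ?_
    linear_combination (n * p) * hp

end PointConfig

theorem natCast_mul_invSqrtProb_sq {k : ℕ} (hk : k ≠ 0) :
    (k : ℝ) * (invSqrtProb k : ℝ) ^ 2 = 1 := by
  have : (0 : ℝ) < k := by positivity
  simp only [invSqrtProb, div_pow, one_pow, Real.sq_sqrt this.le]
  field_simp

theorem tendsto_invSqrtProb : Tendsto (fun k => (invSqrtProb k : ℝ)) atTop (𝓝 0) := by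
  have := (Real.tendsto_sqrt_atTop.comp tendsto_natCast_atTop_atTop).inv_tendsto_atTop
  refine this.congr fun k => ?_
  simp [invSqrtProb]

/-! ### Vanishing of the fold error under cross-validation -/

namespace PointConfig

section CrossValidation

variable {S Ω : Type*} [MetricSpace S] [MeasurableSpace S] [MeasurableSpace Ω]

theorem aemeasurable_foldError [BorelSpace S] [SecondCountableTopology S] {P : Measure Ω}
    {X : Ω → PointConfig S} (hX : Measurable X) (hXfin : ∀ᵐ ω ∂P, (X ω).carrier.Finite)
    {k : ℕ} {p : unitInterval} {XV : Fin k → Ω → PointConfig S} (hXV : IsMonteCarloCV P X k p XV) :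
    AEMeasurable (fun ω => ENNReal.ofReal (foldError p (X ω) fun i => XV i ω)) P := by
  obtain ⟨g, hg, hgeq⟩ := exists_measurable_eq_foldError (S := S) k (p : ℝ)
  refine ⟨fun ω => g (X ω) fun i => XV i ω,
    hg.comp (hX.prodMk (measurable_pi_lambda _ hXV.measurable)), ?_⟩
  filter_upwards [hXfin] with ω hω
  exact (hgeq _ _ hω fun i => hXV.subset i ω).symm

/-- The fold error of a Monte-Carlo cross-validation tends to zero in probability. -/
theorem tendsto_lintegral_min_foldError [BorelSpace S] [SecondCountableTopology S]
    {P : Measure Ω} [IsProbabilityMeasure P] {X : Ω → PointConfig S} (hX : Measurable X)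
    (hXfin : ∀ᵐ ω ∂P, (X ω).carrier.Finite) {XV : (k : ℕ) → Fin k → Ω → PointConfig S}
    (hXV : ∀ k, 2 ≤ k → IsMonteCarloCV P X k (invSqrtProb k) (XV k)) :
    Tendsto (fun k => ∫⁻ ω, min 1 (ENNReal.ofReal
      (foldError (invSqrtProb k) (X ω) fun i => XV k i ω)) ∂P) atTop (𝓝 0) := by
  -- The conditional bound given `n` points. The truncation at 1 supplies the dominating function,
  -- since no moment of the number of points is available.
  let c : ℕ → ℕ → ℝ≥0∞ := fun k n => min 1 (ENNReal.ofReal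
    (2 * n * √(invSqrtProb k : ℝ) + (n : ℝ) ^ 2 * invSqrtProb k + n * invSqrtProb k))
  have hc : ∀ n, Tendsto (fun k => c k n) atTop (𝓝 0) := by
    intro n
    have h := tendsto_invSqrtProb
    have hs : Tendsto (fun k => √(invSqrtProb k : ℝ)) atTop (𝓝 0) := by
      simpa [Function.comp_def] using (Real.continuous_sqrt.tendsto 0).comp h
    have h1 := (((hs.const_mul (2 * (n : ℝ))).add (h.const_mul ((n : ℝ) ^ 2))).add
      (h.const_mul (n : ℝ)))
    have h2 := (tendsto_const_nhds (x := (1 : ℝ≥0∞))).min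
      ((ENNReal.continuous_ofReal.tendsto _).comp h1)
    simpa using h2
  have hN := aemeasurable_ncard hX hXfin
  have hlim : Tendsto (fun k => ∫⁻ ω, c k (X ω).carrier.ncard ∂P) atTop (𝓝 0) := by
    have := tendsto_lintegral_of_dominated_convergence' (μ := P)
      (F := fun k ω => c k (X ω).carrier.ncard) (f := fun _ => 0) (fun _ => 1)
      (fun k => (measurable_from_nat (f := c k)).comp_aemeasurable hN)
      (fun k => ae_of_all _ fun ω => min_le_left _ _) (by simp)
      (ae_of_all _ fun ω => hc _)
    simpa using this
  refine tendsto_of_tendsto_of_tendsto_of_le_of_le' tendsto_const_nhds hlim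
    (Eventually.of_forall fun _ => zero_le) ?_
  filter_upwards [eventually_ge_atTop 2] with k hk
  obtain ⟨g, hg, hgeq⟩ := exists_measurable_eq_foldError (S := S) k (invSqrtProb k : ℝ)
  calc ∫⁻ ω, min 1 (ENNReal.ofReal (foldError (invSqrtProb k) (X ω) fun i => XV k i ω)) ∂P
      = ∫⁻ ω, min 1 (g (X ω) fun i => XV k i ω) ∂P := by
        refine lintegral_congr_ae ?_
        filter_upwards [hXfin] with ω hω
        rw [hgeq _ _ hω fun i => (hXV k hk).subset i ω]
    _ = _ := (hXV k hk).lintegral_eq (fun x v => min 1 (g x v)) (measurable_const.min hg)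
    _ ≤ _ := by
        refine lintegral_mono_ae ?_
        filter_upwards [hXfin] with ω hω
        refine le_min ?_ ?_
        · refine (lintegral_mono fun m => min_le_left _ _).trans ?_
          simp
        · refine le_trans (lintegral_mono fun m => ?_)
            (lintegral_foldError_retain_le (invSqrtProb k)
              (natCast_mul_invSqrtProb_sq (by omega)) (X ω) hω)
          refine (min_le_right _ _).trans (le_of_eq ?_)
          exact hgeq _ _ hω fun i u hu => hu.1

end CrossValidation

/-! ### Sums over the validation sets -/

theorem ncard_mul_ncard_sub_one_nonneg {S : Type*} (s : Set S) : (0 : ℝ) ≤ s.ncard * (s.ncard - 1) := by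
  rcases Nat.eq_zero_or_pos s.ncard with h | h
  · simp [h]
  · have : (1 : ℝ) ≤ s.ncard := by exact_mod_cast h
    exact mul_nonneg (by linarith) (by linarith)

variable {S : Type*} [MetricSpace S]

/-- For finite folds the minimum indicates that the fold is non-empty, and the number of such folds
controls the compensators. -/
theorem sum_min_le_foldError {k : ℕ} {p : ℝ} (hp : 0 ≤ p) (x : PointConfig S)
    (v : Fin k → PointConfig S) :
    p ^ 2 * ∑ i, min 1 ((v i).carrier.ncard : ℝ) ≤ foldError p x v := by
  refine le_add_of_nonneg_left (add_nonneg ?_ ?_)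
  · exact finsum_nonneg fun u => finsum_nonneg fun _ => abs_nonneg _
  · exact mul_nonneg hp (Finset.sum_nonneg fun i _ => ncard_mul_ncard_sub_one_nonneg _)

theorem foldError_ge {k : ℕ} (p : ℝ) (x : PointConfig S) (v : Fin k → PointConfig S) :
    (∑ᶠ u ∈ x.carrier, |p * (∑ i, (v i).carrier.indicator (fun _ => (1 : ℝ)) u) - 1|)
      + p * ∑ i, ((v i).carrier.ncard : ℝ) * ((v i).carrier.ncard - 1) ≤ foldError p x v :=
  le_add_of_nonneg_right (mul_nonneg (sq_nonneg p)
    (Finset.sum_nonneg fun _ _ => le_min zero_le_one (Nat.cast_nonneg _)))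

/-- The sums over the validation sets, multiplied by `p`, are close to the sum over the whole
configuration if the fold error is small. -/
theorem norm_smul_sum_validation_sub_le {E : Type*} [NormedAddCommGroup E] [NormedSpace ℝ E]
    {k : ℕ} {p : ℝ} (hp : 0 ≤ p) {x : PointConfig S} (hx : x.carrier.Finite)
    {v : Fin k → PointConfig S} (hv : ∀ i, (v i).carrier ⊆ x.carrier)
    {h : S → PointConfig S → E} {C : ℝ} (hC : ∀ u y, ‖h u y‖ ≤ C) (hC0 : 0 ≤ C) (A : Set S) :
    ‖p • ∑ i, (∑ᶠ u ∈ (v i).carrier ∩ A, h u ((x.diff (v i)).erase u))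
        - ∑ᶠ u ∈ x.carrier ∩ A, h u (x.erase u)‖ ≤ 2 * C * foldError p x v := by
  classical
  set s := hx.toFinset
  set t := s.filter (· ∈ A)
  let d : Fin k → S → ℝ := fun i u => (v i).carrier.indicator (fun _ => (1 : ℝ)) u
  have hd0 : ∀ i u, 0 ≤ d i u := fun i u => Set.indicator_nonneg (fun _ _ => zero_le_one) u
  have hsum : ∀ i, ∑ᶠ u ∈ (v i).carrier ∩ A, h u ((x.diff (v i)).erase u) =
      ∑ u ∈ t, d i u • h u ((x.diff (v i)).erase u) := by
    intro i
    have hfin : ((v i).carrier ∩ A).Finite := (hx.subset (hv i)).inter_of_left A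
    rw [finsum_mem_eq_finite_toFinset_sum _ hfin]
    have : hfin.toFinset = t.filter (· ∈ (v i).carrier) := by
      ext u
      simp only [Set.Finite.mem_toFinset, Set.mem_inter_iff, Finset.mem_filter, t, s]
      exact ⟨fun hu => ⟨⟨hv i hu.1, hu.2⟩, hu.1⟩, fun hu => ⟨hu.2, hu.1.2⟩⟩
    rw [this, Finset.sum_filter]
    refine Finset.sum_congr rfl fun u _ => ?_
    by_cases hu : u ∈ (v i).carrier <;> simp [d, hu]
  have hsum' : ∑ᶠ u ∈ x.carrier ∩ A, h u (x.erase u) = ∑ u ∈ t, h u (x.erase u) := by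
    rw [finsum_mem_eq_finite_toFinset_sum _ (hx.inter_of_left A)]
    congr 1
    ext u
    simp [t, s]
  have hcard : ∀ i, ((v i).carrier.ncard : ℝ) = ∑ u ∈ s, d i u := by
    intro i
    have : (v i).carrier = ((s.filter (· ∈ (v i).carrier) : Finset S) : Set S) := by
      ext u
      simp only [Finset.coe_filter, Set.mem_ofPred_eq, Set.Finite.mem_toFinset, s]
      exact ⟨fun hu => ⟨hv i hu, hu⟩, fun hu => hu.2⟩
    rw [this, Set.ncard_coe_finset, Finset.card_filter]
    push_cast
    refine Finset.sum_congr rfl fun u _ => ?_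
    by_cases hu : u ∈ (v i).carrier <;> simp [d, hu]
  -- If `u` is alone in its fold, removing the fold and removing `u` is the same, so both sides
  -- vanish. Otherwise the count minus 1 is at least 1 and the trivial bound `2 * C` suffices.
  have hdiff : ∀ i u, d i u * ‖h u ((x.diff (v i)).erase u) - h u (x.erase u)‖ ≤
      d i u * (2 * C * ((v i).carrier.ncard - 1)) := by
    intro i u
    by_cases hu : u ∈ (v i).carrier
    · refine mul_le_mul_of_nonneg_left ?_ (hd0 i u)
      have hfin : (v i).carrier.Finite := hx.subset (hv i)
      have hpos : 0 < (v i).carrier.ncard := (Set.ncard_pos hfin).2 ⟨u, hu⟩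
      rcases Nat.lt_or_ge 1 (v i).carrier.ncard with h1 | h1
      · have h2 : (1 : ℝ) ≤ (v i).carrier.ncard - 1 := by
          have : (2 : ℝ) ≤ (v i).carrier.ncard := by exact_mod_cast h1
          linarith
        calc _ ≤ C + C := (norm_sub_le _ _).trans (add_le_add (hC _ _) (hC _ _))
          _ = 2 * C * 1 := by ring
          _ ≤ _ := mul_le_mul_of_nonneg_left h2 (by positivity)
      · obtain ⟨w, hw⟩ := Set.ncard_eq_one.1 (le_antisymm h1 hpos)
        have : (x.diff (v i)).erase u = x.erase u := by
          have hwu : u = w := by simpa [hw] using hu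
          ext z
          simp [diff, erase, hw, hwu]
        rw [this, sub_self, norm_zero, le_antisymm h1 hpos]
        simp
    · simp [d, hu]
  -- First the error of evaluating `h` at the training set, then the error in how often each point
  -- is validated.
  have hsplit : p • ∑ i, (∑ᶠ u ∈ (v i).carrier ∩ A, h u ((x.diff (v i)).erase u))
        - ∑ᶠ u ∈ x.carrier ∩ A, h u (x.erase u) =
      p • (∑ i, ∑ u ∈ t, d i u • (h u ((x.diff (v i)).erase u) - h u (x.erase u)))
        + ∑ u ∈ t, (p * (∑ i, d i u) - 1) • h u (x.erase u) := by
    have e : ∑ u ∈ t, (p * (∑ i, d i u) - 1) • h u (x.erase u) =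
        p • (∑ i, ∑ u ∈ t, d i u • h u (x.erase u)) - ∑ u ∈ t, h u (x.erase u) := by
      rw [Finset.sum_comm, Finset.smul_sum, ← Finset.sum_sub_distrib]
      refine Finset.sum_congr rfl fun u _ => ?_
      rw [sub_smul, one_smul, mul_smul, Finset.sum_smul]
    simp only [hsum, hsum', e, smul_sub, Finset.sum_sub_distrib]
    abel
  have hts : t ⊆ s := Finset.filter_subset _ _
  rw [hsplit]
  have b1 : ‖p • (∑ i, ∑ u ∈ t, d i u • (h u ((x.diff (v i)).erase u) - h u (x.erase u)))‖ ≤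
      2 * C * (p * ∑ i, ((v i).carrier.ncard : ℝ) * ((v i).carrier.ncard - 1)) := by
    rw [norm_smul, Real.norm_of_nonneg hp]
    have : ‖∑ i, ∑ u ∈ t, d i u • (h u ((x.diff (v i)).erase u) - h u (x.erase u))‖ ≤
        ∑ i, 2 * C * (((v i).carrier.ncard : ℝ) * ((v i).carrier.ncard - 1)) := by
      refine norm_sum_le_of_le _ fun i _ => ?_
      calc _ ≤ ∑ u ∈ t, d i u * ‖h u ((x.diff (v i)).erase u) - h u (x.erase u)‖ :=
            norm_sum_le_of_le _ fun u _ => by rw [norm_smul, Real.norm_of_nonneg (hd0 i u)]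
        _ ≤ ∑ u ∈ s, d i u * ‖h u ((x.diff (v i)).erase u) - h u (x.erase u)‖ :=
            Finset.sum_le_sum_of_subset_of_nonneg hts fun u _ _ =>
              mul_nonneg (hd0 i u) (norm_nonneg _)
        _ ≤ ∑ u ∈ s, d i u * (2 * C * ((v i).carrier.ncard - 1)) :=
            Finset.sum_le_sum fun u _ => hdiff i u
        _ = _ := by rw [← Finset.sum_mul, ← hcard]; ring
    refine (mul_le_mul_of_nonneg_left this hp).trans (le_of_eq ?_)
    rw [← Finset.mul_sum]; ring
  -- Here `C` would do; `2 * C` gives the common factor with `b1`.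
  have b2 : ‖∑ u ∈ t, (p * (∑ i, d i u) - 1) • h u (x.erase u)‖ ≤
      2 * C * ∑ᶠ u ∈ x.carrier, |p * (∑ i, d i u) - 1| := by
    rw [finsum_mem_eq_finite_toFinset_sum _ hx, Finset.mul_sum]
    calc _ ≤ ∑ u ∈ t, |p * (∑ i, d i u) - 1| * C := norm_sum_le_of_le _ fun u _ => by
          rw [norm_smul, Real.norm_eq_abs]
          exact mul_le_mul_of_nonneg_left (hC _ _) (abs_nonneg _)
      _ ≤ ∑ u ∈ s, |p * (∑ i, d i u) - 1| * C :=
          Finset.sum_le_sum_of_subset_of_nonneg hts fun u _ _ => mul_nonneg (abs_nonneg _) hC0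
      _ ≤ _ := Finset.sum_le_sum fun u _ => by nlinarith [abs_nonneg (p * (∑ i, d i u) - 1)]
  calc _ ≤ _ := norm_add_le _ _
    _ ≤ _ := add_le_add b1 b2
    _ = 2 * C * ((∑ᶠ u ∈ x.carrier, |p * (∑ i, d i u) - 1|)
      + p * ∑ i, ((v i).carrier.ncard : ℝ) * ((v i).carrier.ncard - 1)) := by ring
    _ ≤ _ := mul_le_mul_of_nonneg_left (foldError_ge p x v) (by positivity)

end PointConfig

/-! ### Compensators -/

/-- Integrability of `f`, unknown for the estimator, is not required: if the right side is finite,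
then `f = (f - g) + g` is integrable, and otherwise the bound is trivial. -/
theorem enorm_integral_sub_integral_le {α E : Type*} [MeasurableSpace α] {μ : Measure α}
    [NormedAddCommGroup E] [NormedSpace ℝ E] {f g : α → E} (hf : AEStronglyMeasurable f μ)
    (hg : Integrable g μ) :
    ‖∫ a, f a ∂μ - ∫ a, g a ∂μ‖ₑ ≤ ∫⁻ a, ‖f a - g a‖ₑ ∂μ := by
  by_cases h : ∫⁻ a, ‖f a - g a‖ₑ ∂μ = ∞
  · simp [h]
  · have hfg : Integrable (fun a => f a - g a) μ := ⟨hf.sub hg.1, lt_top_iff_ne_top.2 h⟩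
    have hfi : Integrable f μ := (hfg.add hg).congr (ae_of_all _ fun a => by simp)
    rw [← integral_sub hfi hg]
    exact enorm_integral_le_lintegral_enorm _

theorem PointConfig.measurableSet_nonempty {S Ω : Type*} [MetricSpace S] [MeasurableSpace S]
    [OpensMeasurableSpace S] [MeasurableSpace Ω] {X : Ω → PointConfig S} (hX : Measurable X) :
    MeasurableSet {ω | (X ω).carrier.Nonempty} := by
  obtain ⟨K, hK, hKb, hKex⟩ := PointConfig.exists_bounded_exhaustion S
  have : {ω | (X ω).carrier.Nonempty} = ⋃ n, {ω | ((X ω).carrier ∩ K n).ncard ≠ 0} := by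
    ext ω
    simp only [Set.mem_ofPred_eq, Set.mem_iUnion, ne_eq,
      Set.ncard_eq_zero ((X ω).finite_inter _ (hKb _)), ← Set.nonempty_iff_ne_empty]
    constructor
    · rintro ⟨u, hu⟩
      obtain ⟨n, hn⟩ := (hKex {u} (Set.finite_singleton u)).exists
      exact ⟨n, u, hu, hn rfl⟩
    · rintro ⟨n, u, hu, -⟩
      exact ⟨u, hu⟩
  rw [this]
  exact MeasurableSet.iUnion fun n =>
    (measurableSet_eq_fun ((PointConfig.measurable_ncard_inter (hK n) (hKb n)).comp hX)
      measurable_const).compl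

theorem measurable_pplEstimator {S : Type*} [MetricSpace S] [MeasurableSpace S]
    {V : S → PointConfig S → ℝ≥0∞} {lam : S → PointConfig S → ℝ≥0}
    (hV : Measurable (Function.uncurry V)) (hlam : Measurable (Function.uncurry lam)) :
    Measurable (Function.uncurry (pplEstimator V lam)) :=
  (hV.mul hlam.coe_nnreal_ennreal).ennreal_toReal

section Compensator

variable {S Ω E : Type*} [MetricSpace S] [MeasurableSpace S] [MeasurableSpace Ω]
  [NormedAddCommGroup E] [NormedSpace ℝ E] {vol : Measure S} {P : Measure Ω}
  {X XT : Ω → PointConfig S} {p : unitInterval} {lam : S → PointConfig S → ℝ≥0}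
  {V : S → PointConfig S → ℝ≥0∞} {h : S → PointConfig S → E} {C : ℝ≥0} {D : ℝ≥0} {B : Set Ω}

/-- Pointwise in the location, the integrand of the compensator of the training set is close in
`L¹` to that of the whole process, if the two are likely to agree. -/
theorem lintegral_enorm_pplEstimator_smul_sub_le [IsFiniteMeasure P]
    (hX : Measurable X) (hXT : Measurable XT) (hlam : Measurable (Function.uncurry lam))
    (hC : ∀ u x, lam u x ≤ C) (hD : ∀ u x, ‖h u x‖ ≤ D) (hB : MeasurableSet B)
    (hXB : ∀ ω, ω ∉ B → XT ω = X ω) {u : S}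
    (hV : (fun ω => V u (XT ω)) =ᵐ[P] fun ω => ENNReal.ofReal p *
      condLExp (MeasurableSpace.comap XT inferInstance) P
        (fun ω' => (lam u (X ω') : ℝ≥0∞) / (lam u (XT ω') : ℝ≥0∞)) ω) :
    ∫⁻ ω, ‖pplEstimator V lam u (XT ω) • h u (XT ω)
        - ((p : ℝ) * (lam u (X ω) : ℝ)) • h u (X ω)‖ₑ ∂P ≤
      ENNReal.ofReal p * (3 * C * D) * P B := by
  have hp : (0 : ℝ) ≤ p := p.2.1
  have hlamu : Measurable (lam u) := hlam.comp measurable_prodMk_left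
  set W : Ω → ℝ := fun ω => ((condLExp (MeasurableSpace.comap XT inferInstance) P
    (fun ω' => (lam u (X ω') : ℝ≥0∞) / (lam u (XT ω') : ℝ≥0∞)) ω) *
      (lam u (XT ω) : ℝ≥0∞)).toReal - (lam u (XT ω) : ℝ) with hW
  have hW1 : ∫⁻ ω, ‖W ω‖ₑ ∂P ≤ C * P B :=
    lintegral_enorm_mul_condLExp_div_sub_le hXT.comap_le P (Y := fun ω => lam u (X ω))
      (Z := fun ω => lam u (XT ω)) (hlamu.comp hX) (hlamu.comp (comap_measurable XT))
      (fun _ => hC _ _) (fun _ => hC _ _) hB fun ω hω => by rw [hXB ω hω]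
  have hbound : ∀ᵐ ω ∂P, ‖pplEstimator V lam u (XT ω) • h u (XT ω)
        - ((p : ℝ) * (lam u (X ω) : ℝ)) • h u (X ω)‖ₑ ≤
      ENNReal.ofReal p * (D * ‖W ω‖ₑ + B.indicator (fun _ => 2 * (C : ℝ≥0∞) * D) ω) := by
    filter_upwards [hV] with ω hω
    have e1 : pplEstimator V lam u (XT ω) = p * (W ω + lam u (XT ω)) := by
      simp only [pplEstimator, hω, hW, mul_assoc, ENNReal.toReal_mul, ENNReal.toReal_ofReal hp]
      ring
    -- The error of the weight, then that of replacing `XT` by `X`. The first contributes `C * D`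
    -- and the second, which lives on `B`, contributes `2 * C * D`.
    have e2 : pplEstimator V lam u (XT ω) • h u (XT ω)
        - ((p : ℝ) * (lam u (X ω) : ℝ)) • h u (X ω) =
        (p : ℝ) • (W ω • h u (XT ω) +
          ((lam u (XT ω) : ℝ) • h u (XT ω) - (lam u (X ω) : ℝ) • h u (X ω))) := by
      rw [e1]; module
    have hDe : ∀ y, ‖h u y‖ₑ ≤ D := fun y => by
      rw [← ofReal_norm, ← ENNReal.ofReal_coe_nnreal]
      exact ENNReal.ofReal_le_ofReal (hD u y)
    have hCe : ∀ y, ‖(lam u y : ℝ)‖ₑ ≤ C := fun y => by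
      rw [Real.enorm_of_nonneg (lam u y).coe_nonneg, ENNReal.ofReal_coe_nnreal]
      exact_mod_cast hC u y
    rw [e2, enorm_smul, Real.enorm_of_nonneg hp]
    refine mul_le_mul_right ((enorm_add_le _ _).trans (add_le_add ?_ ?_)) _
    · rw [enorm_smul, mul_comm]
      exact mul_le_mul_left (hDe _) _
    · by_cases hωB : ω ∈ B
      · simp only [hωB, Set.indicator_of_mem]
        refine (enorm_sub_le).trans ?_
        rw [enorm_smul, enorm_smul, mul_assoc, two_mul]
        exact add_le_add (mul_le_mul' (hCe _) (hDe _)) (mul_le_mul' (hCe _) (hDe _))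
      · simp [hXB ω hωB]
  refine (lintegral_mono_ae hbound).trans ?_
  rw [lintegral_const_mul' _ _ ENNReal.ofReal_ne_top,
    lintegral_add_right _ (measurable_const.indicator hB),
    lintegral_const_mul' _ _ ENNReal.coe_ne_top, lintegral_indicator hB, setLIntegral_const,
    mul_assoc (ENNReal.ofReal _)]
  refine mul_le_mul_right ?_ _
  calc (D : ℝ≥0∞) * ∫⁻ ω, ‖W ω‖ₑ ∂P + 2 * C * D * P B ≤ D * (C * P B) + 2 * C * D * P B :=
        add_le_add_left (mul_le_mul_right hW1 _) _
    _ = 3 * C * D * P B := by ring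

variable [FiniteDimensional ℝ E] [MeasurableSpace E] [BorelSpace E]

/-- The compensator of the training set is close in `L¹` to `p` times that of the whole process. -/
theorem lintegral_lintegral_enorm_pplEstimator_smul_sub_le [SigmaFinite vol] [IsFiniteMeasure P]
    (hX : Measurable X) (hXT : Measurable XT) (hlam : Measurable (Function.uncurry lam))
    (hh : Measurable (Function.uncurry h))
    (hC : ∀ u x, lam u x ≤ C) (hD : ∀ u x, ‖h u x‖ ≤ D) (hB : MeasurableSet B)
    (hXB : ∀ ω, ω ∉ B → XT ω = X ω) (hV : IsPPLWeight vol P X XT p lam V) (A : Set S) :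
    ∫⁻ ω, ∫⁻ u in A, ‖pplEstimator V lam u (XT ω) • h u (XT ω)
        - ((p : ℝ) * (lam u (X ω) : ℝ)) • h u (X ω)‖ₑ ∂vol ∂P ≤
      ENNReal.ofReal p * (3 * C * D) * P B * vol A := by
  have hmT : Measurable fun z : Ω × S => (z.2, XT z.1) :=
    measurable_snd.prodMk (hXT.comp measurable_fst)
  have hmX : Measurable fun z : Ω × S => (z.2, X z.1) :=
    measurable_snd.prodMk (hX.comp measurable_fst)
  have hmeas : Measurable fun z : Ω × S => ‖pplEstimator V lam z.2 (XT z.1) • h z.2 (XT z.1)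
        - ((p : ℝ) * (lam z.2 (X z.1) : ℝ)) • h z.2 (X z.1)‖ₑ :=
    ((((measurable_pplEstimator hV.measurable hlam).comp hmT).smul (hh.comp hmT)).sub
      (((hlam.comp hmX).coe_nnreal_real.const_mul _).smul (hh.comp hmX))).enorm
  -- The weight is identified almost surely for almost every fixed `u`, so `ω` must be integrated
  -- first.
  rw [lintegral_lintegral_swap hmeas.aemeasurable]
  calc _ ≤ ∫⁻ _ in A, ENNReal.ofReal p * (3 * C * D) * P B ∂vol := by
        refine lintegral_mono_ae (ae_restrict_of_ae ?_)
        filter_upwards [hV.ae_eq] with u hu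
        exact lintegral_enorm_pplEstimator_smul_sub_le hX hXT hlam hC hD hB hXB hu
    _ = _ := setLIntegral_const _ _

end Compensator

/-! ### Convergence in probability -/

section InMeasure

variable {Ω E : Type*} [MeasurableSpace Ω] {P : Measure Ω} [NormedAddCommGroup E]

/-- Markov's inequality applied separately to the truncated `F` and to `R`. -/
theorem tendstoInMeasure_zero_of_enorm_le {Y : ℕ → Ω → E} {F R : ℕ → Ω → ℝ≥0∞} {c : ℝ≥0∞}
    (hc : c ≠ ∞) (hF : ∀ᶠ k in atTop, AEMeasurable (F k) P)
    (hR : ∀ᶠ k in atTop, AEMeasurable (R k) P)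
    (hF0 : Tendsto (fun k => ∫⁻ ω, min 1 (F k ω) ∂P) atTop (𝓝 0))
    (hR0 : Tendsto (fun k => ∫⁻ ω, R k ω ∂P) atTop (𝓝 0))
    (hY : ∀ᶠ k in atTop, ∀ᵐ ω ∂P, ‖Y k ω‖ₑ ≤ c * F k ω + R k ω) :
    TendstoInMeasure P Y atTop fun _ => 0 := by
  refine tendstoInMeasure_of_ne_top fun ε hε hεt => ?_
  have hε2 : ε / 2 ≠ 0 := by simp [hε.ne']
  have hc1 : c + 1 ≠ ∞ := by simp [hc]
  -- With `δ ≤ 1`, the truncation is inactive below `δ`; `c + 1` avoids dividing by zero.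
  set δ : ℝ≥0∞ := min 1 (ε / 2 / (c + 1)) with hδ
  have hδ0 : δ ≠ 0 := by
    have : 0 < ε / 2 / (c + 1) := ENNReal.div_pos hε2 hc1
    exact (lt_min one_pos this).ne'
  have hδt : δ ≠ ∞ := ((min_le_left _ _).trans_lt ENNReal.one_lt_top).ne
  have hε2t : ε / 2 ≠ ∞ := (ENNReal.div_lt_top hεt (by simp)).ne
  have hlim : Tendsto (fun k => (∫⁻ ω, min 1 (F k ω) ∂P) / δ + (∫⁻ ω, R k ω ∂P) / (ε / 2))
      atTop (𝓝 0) := by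
    have h1 := ENNReal.Tendsto.div_const hF0 (b := δ) (Or.inr hδ0)
    have h2 := ENNReal.Tendsto.div_const hR0 (b := ε / 2) (Or.inr hε2)
    simpa using h1.add h2
  refine tendsto_of_tendsto_of_tendsto_of_le_of_le' tendsto_const_nhds hlim
    (Eventually.of_forall fun _ => zero_le) ?_
  filter_upwards [hF, hR, hY] with k hFk hRk hYk
  calc P {ω | ε ≤ edist (Y k ω) 0}
      ≤ P ({ω | δ ≤ min 1 (F k ω)} ∪ {ω | ε / 2 ≤ R k ω}) := by
        refine measure_mono_ae ?_
        filter_upwards [hYk] with ω hω hεω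
        by_contra hcon
        have hcon : ¬ (δ ≤ min 1 (F k ω) ∨ ε / 2 ≤ R k ω) := hcon
        rw [not_or, not_le, not_le] at hcon
        have hFδ : F k ω < ε / 2 / (c + 1) := by
          rcases min_lt_iff.1 hcon.1 with h | h
          · exact absurd h (not_lt.2 (min_le_left _ _))
          · exact h.trans_le (min_le_right _ _)
        have h1 : c * F k ω ≤ ε / 2 := by
          calc c * F k ω ≤ (c + 1) * (ε / 2 / (c + 1)) := mul_le_mul' le_self_add hFδ.le
            _ ≤ ε / 2 := ENNReal.mul_div_le
        have h2 : c * F k ω + R k ω < ε := by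
          calc c * F k ω + R k ω < ε / 2 + ε / 2 :=
                ENNReal.add_lt_add_of_le_of_lt (h1.trans_lt hε2t.lt_top).ne h1 hcon.2
            _ = ε := ENNReal.add_halves ε
        have h3 : ε ≤ ‖Y k ω‖ₑ := by
          have : ε ≤ edist (Y k ω) 0 := hεω
          rwa [edist_zero_right] at this
        exact absurd (h3.trans hω) (not_le.2 h2)
    _ ≤ _ := (measure_union_le _ _).trans (add_le_add
        (meas_ge_le_lintegral_div (aemeasurable_const.min hFk) hδ0 hδt)
        (meas_ge_le_lintegral_div hRk hε2 hε2t))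

/-- Squared norms converge in measure if the limit is tight. -/
theorem tendstoInMeasure_norm_sq_sub_norm_sq {a : ℕ → Ω → E} {b : Ω → E}
    (hab : TendstoInMeasure P (fun k ω => a k ω - b ω) atTop fun _ => 0)
    (hb : ∀ δ : ℝ≥0∞, 0 < δ → ∃ M : ℝ, P {ω | M < ‖b ω‖} ≤ δ) :
    TendstoInMeasure P (fun k ω => ‖a k ω‖ ^ 2 - ‖b ω‖ ^ 2) atTop fun _ => 0 := by
  rw [tendstoInMeasure_iff_norm] at hab ⊢
  intro ε hε
  rw [ENNReal.tendsto_nhds_zero]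
  intro δ hδ
  obtain ⟨M, hM⟩ := hb (δ / 2) (ENNReal.half_pos hδ.ne')
  -- If `‖b‖ ≤ |M|` and `‖a - b‖ < η ≤ 1`, the squares differ by at most `η * (1 + 2 * |M|) ≤ ε /
  -- 2`, strictly less than `ε`.
  set η : ℝ := min 1 (ε / (2 * (1 + 2 * |M|))) with hη
  have hM0 : 0 ≤ |M| := abs_nonneg M
  have hη0 : 0 < η := lt_min one_pos (by positivity)
  filter_upwards [(ENNReal.tendsto_nhds_zero.1 (hab η hη0)) (δ / 2) (ENNReal.half_pos hδ.ne')]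
    with k hk
  calc _ ≤ P ({ω | M < ‖b ω‖} ∪ {ω | η ≤ ‖a k ω - b ω - 0‖}) := by
        refine measure_mono fun ω hω => ?_
        by_contra hcon
        have hcon : ¬ (M < ‖b ω‖ ∨ η ≤ ‖a k ω - b ω - 0‖) := hcon
        rw [not_or, not_lt, not_le, sub_zero] at hcon
        have hω : ε ≤ ‖‖a k ω‖ ^ 2 - ‖b ω‖ ^ 2 - 0‖ := hω
        rw [sub_zero, Real.norm_eq_abs] at hω
        obtain ⟨h1, h2⟩ := hcon
        have h3 : |‖a k ω‖ - ‖b ω‖| ≤ ‖a k ω - b ω‖ := abs_norm_sub_norm_le _ _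
        have h4 : ‖a k ω‖ ≤ ‖a k ω - b ω‖ + ‖b ω‖ := by
          simpa using norm_add_le (a k ω - b ω) (b ω)
        have h5 : ‖b ω‖ ≤ |M| := h1.trans (le_abs_self M)
        have h6 : η ≤ 1 := min_le_left _ _
        have h7 : η * (1 + 2 * |M|) ≤ ε / 2 := by
          have : η ≤ ε / (2 * (1 + 2 * |M|)) := min_le_right _ _
          rw [le_div_iff₀ (by positivity)] at this
          linarith
        have h8 : |‖a k ω‖ ^ 2 - ‖b ω‖ ^ 2| ≤ η * (1 + 2 * |M|) := by
          rw [sq_sub_sq, abs_mul, mul_comm, abs_of_nonneg (by positivity : 0 ≤ ‖a k ω‖ + ‖b ω‖)]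
          exact mul_le_mul (h3.trans h2.le) (by linarith) (by positivity) hη0.le
        linarith
    _ ≤ δ / 2 + δ / 2 := (measure_union_le _ _).trans (add_le_add hM hk)
    _ = δ := ENNReal.add_halves δ

/-- An almost surely finite count is tight. -/
theorem exists_measure_lt_natCast_le [IsFiniteMeasure P] {N : Ω → ℕ} (hN : AEMeasurable N P)
    {δ : ℝ≥0∞} (hδ : 0 < δ) : ∃ L : ℕ, P {ω | L < N ω} ≤ δ := by
  have h := tendsto_measure_iInter_atTop (μ := P) (s := fun L : ℕ => {ω | L < N ω})
    (fun L => hN.nullMeasurable (measurableSet_Ioi (a := L)))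
    (fun L M hLM ω (hω : M < N ω) => lt_of_le_of_lt hLM hω) ⟨0, measure_ne_top P _⟩
  have hempty : (⋂ L : ℕ, {ω | L < N ω}) = ∅ := by
    ext ω
    simp only [Set.mem_iInter, Set.mem_empty_iff_false, iff_false, not_forall]
    exact ⟨N ω, fun h : N ω < N ω => lt_irrefl _ h⟩
  rw [hempty, measure_empty] at h
  exact ((ENNReal.tendsto_nhds_zero.1 h) δ hδ).exists

end InMeasure

/-! ### Assembly of the estimates -/

theorem integrableOn_smul_of_bounded {S E : Type*} [MetricSpace S] [MeasurableSpace S]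
    [NormedAddCommGroup E] [NormedSpace ℝ E] [FiniteDimensional ℝ E] [MeasurableSpace E]
    [BorelSpace E] {vol : Measure S} {A : Set S} (hA : vol A < ∞)
    {lam : S → PointConfig S → ℝ≥0} (hlam : Measurable (Function.uncurry lam))
    {h : S → PointConfig S → E} (hh : Measurable (Function.uncurry h)) {C D : ℝ≥0}
    (hC : ∀ u x, lam u x ≤ C) (hD : ∀ u x, ‖h u x‖ ≤ D) (x : PointConfig S) :
    IntegrableOn (fun u => (lam u x : ℝ) • h u x) A vol := by
  refine IntegrableOn.of_bound hA ?_ (C * D) (ae_of_all _ fun u => ?_)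
  · exact ((hlam.comp measurable_prodMk_right).coe_nnreal_real.smul
      (hh.comp measurable_prodMk_right)).aestronglyMeasurable
  · rw [norm_smul, Real.norm_of_nonneg (lam u x).coe_nonneg]
    exact mul_le_mul (by exact_mod_cast hC u x) (hD u x) (norm_nonneg _) C.coe_nonneg

/-- Reduces tightness of the innovation to that of the number of points. -/
theorem norm_innovation_le {S E : Type*} [MetricSpace S] [MeasurableSpace S]
    [NormedAddCommGroup E] [NormedSpace ℝ E] {vol : Measure S} {A : Set S} (hA : vol A < ∞)
    {lam : S → PointConfig S → ℝ≥0} {h : S → PointConfig S → E} {C D : ℝ≥0}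
    (hC : ∀ u x, lam u x ≤ C) (hD : ∀ u x, ‖h u x‖ ≤ D) {x : PointConfig S}
    (hx : x.carrier.Finite) :
    ‖innovation vol lam h A x‖ ≤ D * x.carrier.ncard + C * D * vol.real A := by
  classical
  refine (norm_sub_le _ _).trans (add_le_add ?_ ?_)
  · rw [finsum_mem_eq_finite_toFinset_sum _ (hx.inter_of_left A)]
    refine (norm_sum_le_of_le _ fun u _ => hD u _).trans ?_
    rw [Finset.sum_const, nsmul_eq_mul, mul_comm, ← Set.ncard_eq_toFinset_card _ (hx.inter_of_left A)]
    gcongr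
    exact Set.inter_subset_left
  · refine norm_setIntegral_le_of_norm_le_const hA fun u _ => ?_
    rw [norm_smul, Real.norm_of_nonneg (lam u x).coe_nonneg]
    exact mul_le_mul (by exact_mod_cast hC u x) (hD u x) (norm_nonneg _) C.coe_nonneg

/-- The rescaled sum of the prediction errors of a cross-validation differs from the innovation by
at most the fold error and the errors of the compensators. -/
theorem enorm_smul_sum_predictionError_sub_innovation_le {S E : Type*} [MetricSpace S]
    [MeasurableSpace S] [NormedAddCommGroup E] [NormedSpace ℝ E] [FiniteDimensional ℝ E]
    [MeasurableSpace E] [BorelSpace E] {vol : Measure S} {A : Set S} (hA : vol A < ∞)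
    {lam : S → PointConfig S → ℝ≥0} (hlam : Measurable (Function.uncurry lam))
    {h : S → PointConfig S → E} (hh : Measurable (Function.uncurry h)) {C D : ℝ≥0}
    (hC : ∀ u x, lam u x ≤ C) (hD : ∀ u x, ‖h u x‖ ≤ D) {k : ℕ} {p : ℝ} (hp : 0 ≤ p)
    (hkp : (k : ℝ) * p ^ 2 = 1) {xi : Fin k → S → PointConfig S → ℝ}
    (hxi : ∀ i, Measurable (Function.uncurry (xi i))) {x : PointConfig S} (hx : x.carrier.Finite)
    {v : Fin k → PointConfig S} (hv : ∀ i, (v i).carrier ⊆ x.carrier) :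
    ‖p • ∑ i, predictionError vol (xi i) h A (v i) (x.diff (v i)) - innovation vol lam h A x‖ₑ ≤
      ENNReal.ofReal (2 * D) * ENNReal.ofReal (PointConfig.foldError p x v) +
      ENNReal.ofReal p * ∑ i, ∫⁻ u in A, ‖xi i u (x.diff (v i)) • h u (x.diff (v i))
        - (p * (lam u x : ℝ)) • h u x‖ₑ ∂vol := by
  have hint := integrableOn_smul_of_bounded hA hlam hh hC hD x
  -- By `k * p ^ 2 = 1`, the integral in the innovation is shared out evenly among the folds.
  have hpint : ∫ u in A, (lam u x : ℝ) • h u x ∂vol =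
      p • ∑ _i : Fin k, ∫ u in A, (p * (lam u x : ℝ)) • h u x ∂vol := by
    simp only [mul_smul, integral_smul, Finset.sum_const, Finset.card_univ, Fintype.card_fin]
    rw [← Nat.cast_smul_eq_nsmul ℝ, smul_smul, smul_smul,
      show p * k * p = 1 by linear_combination hkp, one_smul]
  have hsplit : p • ∑ i, predictionError vol (xi i) h A (v i) (x.diff (v i))
        - innovation vol lam h A x =
      (p • ∑ i, (∑ᶠ u ∈ (v i).carrier ∩ A, h u ((x.diff (v i)).erase u))
        - ∑ᶠ u ∈ x.carrier ∩ A, h u (x.erase u))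
      - p • ∑ i, ((∫ u in A, xi i u (x.diff (v i)) • h u (x.diff (v i)) ∂vol)
        - ∫ u in A, (p * (lam u x : ℝ)) • h u x ∂vol) := by
    simp only [innovation, predictionError, Finset.sum_sub_distrib, smul_sub, ← hpint]
    abel
  rw [hsplit]
  refine enorm_sub_le.trans (add_le_add ?_ ?_)
  · rw [← ofReal_norm, ← ENNReal.ofReal_mul (by positivity)]
    exact ENNReal.ofReal_le_ofReal
      (PointConfig.norm_smul_sum_validation_sub_le hp hx hv hD D.coe_nonneg A)
  · rw [enorm_smul, Real.enorm_of_nonneg hp]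
    refine mul_le_mul_right ((enorm_sum_le _ _).trans (Finset.sum_le_sum fun i _ => ?_)) _
    refine enorm_integral_sub_integral_le ?_ ?_
    · exact (((hxi i).comp measurable_prodMk_right).smul
        (hh.comp measurable_prodMk_right)).aestronglyMeasurable
    · simp only [mul_smul]
      exact hint.smul p

theorem theorem1 {S Ω Θ E : Type*}
    [MetricSpace S] [CompleteSpace S] [SecondCountableTopology S]
    [MeasurableSpace S] [BorelSpace S]
    [NormedAddCommGroup E] [NormedSpace ℝ E] [FiniteDimensional ℝ E]
    [MeasurableSpace E] [BorelSpace E]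
    -- the reference measure: non-atomic, `σ`-finite, finite on bounded sets
    (vol : Measure S) [NullSingletonClass vol] [SigmaFinite vol]
    (hvol : ∀ B : Set S, Bornology.IsBounded B → vol B < ∞)
    -- a finite point process
    [MeasurableSpace Ω] (P : Measure Ω) [IsProbabilityMeasure P]
    (X : Ω → PointConfig S) (hX : Measurable X) (hXfin : ∀ᵐ ω ∂P, (X ω).carrier.Finite)
    -- the model family, containing the conditional intensity of `X`, and the test functions
    (lam : Θ → S → PointConfig S → ℝ≥0) (hlam : ∀ θ, Measurable (Function.uncurry (lam θ)))
    (θ₀ : Θ) (hθ₀ : HasConditionalIntensity vol P X (lam θ₀))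
    (h : Θ → S → PointConfig S → E) (hh : ∀ θ, Measurable (Function.uncurry (h θ)))
    (hlam_bdd : ∀ θ, ∃ C : ℝ≥0, ∀ u x, lam θ u x ≤ C)
    (hh_bdd : ∀ θ, ∃ C : ℝ, ∀ u x, ‖h θ u x‖ ≤ C)
    -- Monte-Carlo cross-validations with retention probabilities `1 / √k`
    (XV XT : (k : ℕ) → Fin k → Ω → PointConfig S)
    (hXV : ∀ k, 2 ≤ k → IsMonteCarloCV P X k (invSqrtProb k) (XV k))
    (hXT : ∀ k i ω, XT k i ω = (X ω).diff (XV k i ω))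
    -- the associated PPL-weights
    (V : Θ → (k : ℕ) → Fin k → S → PointConfig S → ℝ≥0∞)
    (hV : ∀ θ k i, 2 ≤ k → IsPPLWeight vol P X (XT k i) (invSqrtProb k) (lam θ) (V θ k i))
    (θ : Θ) (A : Set S) (hA : MeasurableSet A) (hAb : Bornology.IsBounded A) :
    TendstoInMeasure P
      (fun (k : ℕ) ω =>
        (invSqrtProb k : ℝ) • ∑ i : Fin k,
            predictionError vol (pplEstimator (V θ k i) (lam θ)) (h θ) A (XV k i ω) (XT k i ω)
          - innovation vol (lam θ) (h θ) A (X ω))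
      atTop (fun _ => 0) ∧
    TendstoInMeasure P
      (fun (k : ℕ) ω =>
        (k : ℝ) * lossL3 (fun i : Fin k =>
            predictionError vol (pplEstimator (V θ k i) (lam θ)) (h θ) A (XV k i ω) (XT k i ω))
          - ‖innovation vol (lam θ) (h θ) A (X ω)‖ ^ 2)
      atTop (fun _ => 0) := by
  obtain ⟨C, hC⟩ := hlam_bdd θ
  obtain ⟨D, hD⟩ : ∃ D : ℝ≥0, ∀ u x, ‖h θ u x‖ ≤ D := by
    obtain ⟨D, hD⟩ := hh_bdd θ
    exact ⟨D.toNNReal, fun u x => (hD u x).trans (Real.le_coe_toNNReal D)⟩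
  have hAfin : vol A < ∞ := hvol A hAb
  have hXTeq : ∀ k i, XT k i = fun ω => (X ω).diff (XV k i ω) := fun k i => funext (hXT k i)
  have hXTm : ∀ k i, 2 ≤ k → Measurable (XT k i) := fun k i hk => by
    rw [hXTeq]
    exact PointConfig.measurable_diff hX ((hXV k hk).measurable i) ((hXV k hk).subset i)
  let B : (k : ℕ) → Fin k → Set Ω := fun k i => {ω | (XV k i ω).carrier.Nonempty}
  have hB : ∀ k i, 2 ≤ k → MeasurableSet (B k i) := fun k i hk =>
    PointConfig.measurableSet_nonempty ((hXV k hk).measurable i)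
  have hXB : ∀ k i ω, ω ∉ B k i → XT k i ω = X ω := by
    intro k i ω hω
    have : (XV k i ω).carrier = ∅ := Set.not_nonempty_iff_eq_empty.1 hω
    rw [hXT]
    ext u
    simp [PointConfig.diff, this]
  have hp0 : ∀ k, (0 : ℝ) ≤ invSqrtProb k := fun k => (invSqrtProb k).2.1
  let F : ℕ → Ω → ℝ≥0∞ := fun k ω =>
    ENNReal.ofReal (PointConfig.foldError (invSqrtProb k) (X ω) fun i => XV k i ω)
  let J : (k : ℕ) → Fin k → Ω → ℝ≥0∞ := fun k i ω =>
    ∫⁻ u in A, ‖pplEstimator (V θ k i) (lam θ) u (XT k i ω) • h θ u (XT k i ω)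
      - ((invSqrtProb k : ℝ) * (lam θ u (X ω) : ℝ)) • h θ u (X ω)‖ₑ ∂vol
  have hJm : ∀ k i, 2 ≤ k → Measurable (J k i) := by
    intro k i hk
    have hmT : Measurable fun z : Ω × S => (z.2, XT k i z.1) :=
      measurable_snd.prodMk ((hXTm k i hk).comp measurable_fst)
    have hmX : Measurable fun z : Ω × S => (z.2, X z.1) :=
      measurable_snd.prodMk (hX.comp measurable_fst)
    exact Measurable.lintegral_prod_right
      ((((measurable_pplEstimator (hV θ k i hk).measurable (hlam θ)).comp hmT).smul
        ((hh θ).comp hmT)).sub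
        ((((hlam θ).comp hmX).coe_nnreal_real.const_mul _).smul ((hh θ).comp hmX))).enorm
  let R : ℕ → Ω → ℝ≥0∞ := fun k ω => ENNReal.ofReal (invSqrtProb k) * ∑ i, J k i ω
  have hRm : ∀ k, 2 ≤ k → Measurable (R k) := fun k hk =>
    (Finset.measurable_fun_sum _ fun i _ => hJm k i hk).const_mul _
  have hF0 : Tendsto (fun k => ∫⁻ ω, min 1 (F k ω) ∂P) atTop (𝓝 0) :=
    PointConfig.tendsto_lintegral_min_foldError hX hXfin hXV
  -- The two factors `p`, one from the rescaling and one from the weight, combine to `p ^ 2` times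
  -- the number of non-empty folds. This is at most 1, there being `k` folds, and at most the fold
  -- error.
  have hRle : ∀ k, 2 ≤ k →
      ∫⁻ ω, R k ω ∂P ≤ (3 * C * D * vol A) * ∫⁻ ω, min 1 (F k ω) ∂P := by
    intro k hk
    have hind : ∀ i, P (B k i) = ∫⁻ ω, (B k i).indicator (fun _ => (1 : ℝ≥0∞)) ω ∂P := by
      intro i
      rw [lintegral_indicator (hB k i hk)]
      simp
    calc ∫⁻ ω, R k ω ∂P = ENNReal.ofReal (invSqrtProb k) * ∑ i, ∫⁻ ω, J k i ω ∂P := by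
          rw [lintegral_const_mul' _ _ ENNReal.ofReal_ne_top,
            lintegral_finsetSum _ fun i _ => hJm k i hk]
      _ ≤ ENNReal.ofReal (invSqrtProb k) * ∑ i,
            ENNReal.ofReal (invSqrtProb k) * (3 * C * D) * P (B k i) * vol A := by
          refine mul_le_mul_right (Finset.sum_le_sum fun i _ => ?_) _
          exact lintegral_lintegral_enorm_pplEstimator_smul_sub_le hX (hXTm k i hk) (hlam θ) (hh θ)
            hC hD (hB k i hk) (hXB k i) (hV θ k i hk) A
      _ = (3 * C * D * vol A) * ∫⁻ ω, ENNReal.ofReal (invSqrtProb k) ^ 2 *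
            ∑ i, (B k i).indicator (fun _ => (1 : ℝ≥0∞)) ω ∂P := by
          rw [lintegral_const_mul' _ _ (ENNReal.pow_ne_top ENNReal.ofReal_ne_top),
            lintegral_finsetSum _ fun i _ => measurable_const.indicator (hB k i hk)]
          simp only [← hind, Finset.mul_sum]
          refine Finset.sum_congr rfl fun i _ => ?_
          ring
      _ ≤ _ := by
          refine mul_le_mul_right (lintegral_mono_ae ?_) _
          filter_upwards [hXfin] with ω hω
          have hmin : ENNReal.ofReal (invSqrtProb k) ^ 2 *
              ∑ i, (B k i).indicator (fun _ => (1 : ℝ≥0∞)) ω =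
              ENNReal.ofReal ((invSqrtProb k : ℝ) ^ 2 *
                ∑ i, min 1 ((XV k i ω).carrier.ncard : ℝ)) := by
            rw [ENNReal.ofReal_mul (sq_nonneg _), ENNReal.ofReal_pow (hp0 k),
              ENNReal.ofReal_sum_of_nonneg fun i _ => le_min zero_le_one (Nat.cast_nonneg _)]
            congr 1
            refine Finset.sum_congr rfl fun i _ => ?_
            by_cases hi : ω ∈ B k i
            · have h1 : 0 < (XV k i ω).carrier.ncard :=
                (Set.ncard_pos (hω.subset ((hXV k hk).subset i ω))).2 hi
              have h2 : (1 : ℝ) ≤ (XV k i ω).carrier.ncard := by exact_mod_cast h1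
              simp [hi, min_eq_left h2]
            · have : (XV k i ω).carrier = ∅ := Set.not_nonempty_iff_eq_empty.1 hi
              simp [hi, this]
          rw [hmin]
          refine le_min ?_ (ENNReal.ofReal_le_ofReal (PointConfig.sum_min_le_foldError (hp0 k) _ _))
          rw [← ENNReal.ofReal_one]
          refine ENNReal.ofReal_le_ofReal ?_
          calc _ ≤ (invSqrtProb k : ℝ) ^ 2 * ∑ _i : Fin k, (1 : ℝ) := by
                gcongr
                exact min_le_left _ _
            _ = 1 := by
                simpa [mul_comm] using natCast_mul_invSqrtProb_sq (k := k) (by omega)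
  have hR0 : Tendsto (fun k => ∫⁻ ω, R k ω ∂P) atTop (𝓝 0) := by
    have hc : (3 * C * D * vol A : ℝ≥0∞) ≠ ∞ := by finiteness
    have hlim := ENNReal.Tendsto.const_mul hF0 (a := (3 * C * D * vol A : ℝ≥0∞)) (Or.inr hc)
    rw [mul_zero] at hlim
    refine tendsto_of_tendsto_of_tendsto_of_le_of_le' tendsto_const_nhds hlim
      (Eventually.of_forall fun _ => zero_le) ?_
    filter_upwards [eventually_ge_atTop 2] with k hk using hRle k hk
  have hmain : TendstoInMeasure P
      (fun (k : ℕ) ω =>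
        (invSqrtProb k : ℝ) • ∑ i : Fin k,
            predictionError vol (pplEstimator (V θ k i) (lam θ)) (h θ) A (XV k i ω) (XT k i ω)
          - innovation vol (lam θ) (h θ) A (X ω))
      atTop (fun _ => 0) := by
    refine tendstoInMeasure_zero_of_enorm_le (F := F) (R := R) (c := ENNReal.ofReal (2 * D))
      ENNReal.ofReal_ne_top ?_ ?_ hF0 hR0 ?_
    · filter_upwards [eventually_ge_atTop 2] with k hk
      exact PointConfig.aemeasurable_foldError hX hXfin (hXV k hk)
    · filter_upwards [eventually_ge_atTop 2] with k hk using (hRm k hk).aemeasurable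
    · filter_upwards [eventually_ge_atTop 2] with k hk
      filter_upwards [hXfin] with ω hω
      simp only [F, R, J, hXT]
      exact enorm_smul_sum_predictionError_sub_innovation_le hAfin (hlam θ) (hh θ) hC hD (hp0 k)
        (natCast_mul_invSqrtProb_sq (by omega))
        (fun i => measurable_pplEstimator (hV θ k i hk).measurable (hlam θ)) hω
        fun i => (hXV k hk).subset i ω
  refine ⟨hmain, ?_⟩
  refine (tendstoInMeasure_norm_sq_sub_norm_sq hmain fun δ hδ => ?_).congr' ?_ EventuallyEq.rfl
  · obtain ⟨L, hL⟩ :=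
      exists_measure_lt_natCast_le (PointConfig.aemeasurable_ncard hX hXfin) hδ
    refine ⟨D * L + C * D * vol.real A, (measure_mono_ae ?_).trans hL⟩
    filter_upwards [hXfin] with ω hω hωL
    by_contra hcon
    have hcon : (X ω).carrier.ncard ≤ L := not_lt.1 hcon
    have hωL : D * L + C * D * vol.real A < ‖innovation vol (lam θ) (h θ) A (X ω)‖ := hωL
    have h1 := norm_innovation_le hAfin hC hD hω
    have h2 : (D : ℝ) * (X ω).carrier.ncard ≤ D * L := by gcongr
    linarith
  · filter_upwards [eventually_ge_atTop 2] with k hk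
    refine ae_of_all _ fun ω => ?_
    have hk0 : (k : ℝ) ≠ 0 := by positivity
    have hkp := natCast_mul_invSqrtProb_sq (k := k) (by omega)
    -- Hence `k` times the loss is exactly the squared norm of the rescaled sum.
    have hp2 : (invSqrtProb k : ℝ) ^ 2 = k * (1 / (k : ℝ)) ^ 2 := by
      field_simp
      linarith
    simp only [lossL3, norm_smul, mul_pow, Real.norm_eq_abs, sq_abs, hp2]
    ring
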